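/- For a finite graph $G$ and $k,t\in\mathbb N$, let $\mathcal H(G,k,t)$ be the graph whose vertices are the proper $k$-colourings of $G$ (with colours $1,\dots,k$), two distinct colourings being adjacent if they differ on at most $t$ vertices. In a proper $k$-colouring $\tau$ of $G$, a vertex $v$ is called $t$-loose if for every colour $j$ there is a neighbour $\sigma$ of $\tau$ in $\mathcal H(G,k,t)$ with $\sigma(v)=j$, and thawed if for every colour $j$ there is $\sigma$ in the connected component of $\tau$ in $\mathcal H(G,k,1)$ with $\sigma(v)=j$. Theorem. There is an absolute constant $C>0$ such that for every $\varepsilon>0$ there is $k_0$ such that the following holds for all integers $k\ge k_0$ and $\Delta\ge 0$ with $\Delta\le(1-\varepsilon)k\ln k$. For every $\delta>0$ there is $N=N(\varepsilon,k,\Delta,\delta)$ such that, for every $n\ge N$ and every simple graph $G$ on $n$ vertices with maximum degree at most $\Delta$ and girth at least $\ln\ln n$ (forests have infinite girth), a uniformly random proper $k$-colouring $\boldsymbol\sigma$ of $G$ satisfies, with probability at least $1-\delta$: every vertex $v$ of $G$ is both $\lfloor C(\ln n)^2\rfloor$-loose in $\boldsymbol\sigma$ and thawed in $\boldsymbol\sigma$.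 In particular $G$ has a proper $k$-colouring. -/

import Mathlib

/-- The distance-`t` `k`-colouring graph `H(G, k, t)`: its vertices are the proper `k`-colourings
of `G`, two distinct ones being adjacent when their Hamming distance is at most `t`. -/
def colouringGraph {V : Type*} [Fintype V] (G : SimpleGraph V) (k t : ℕ) :
    SimpleGraph (G.Coloring (Fin k)) where
  Adj τ σ := τ ≠ σ ∧ hammingDist (fun v => τ v) (fun v => σ v) ≤ t
  symm := ⟨fun τ σ h => ⟨h.1.symm, by rw [hammingDist_comm]; exact h.2⟩⟩
  loopless := ⟨fun _ h => h.1 rfl⟩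

/-- `v` is `t`-loose in `τ`: every colour occurs at `v` in some neighbour of `τ` in `H(G, k, t)`. -/
def IsLoose {V : Type*} [Fintype V] {G : SimpleGraph V} {k : ℕ} (t : ℕ)
    (τ : G.Coloring (Fin k)) (v : V) : Prop :=
  ∀ j : Fin k, ∃ σ : G.Coloring (Fin k), (colouringGraph G k t).Adj τ σ ∧ σ v = j

/-- `v` is `t`-thawed in `τ`: every colour occurs at `v` in some colouring of the `t`-cluster
(connected component of `H(G, k, t)`) of `τ`. -/
def IsThawedAt {V : Type*} [Fintype V] {G : SimpleGraph V} {k : ℕ} (t : ℕ)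
    (τ : G.Coloring (Fin k)) (v : V) : Prop :=
  ∀ j : Fin k, ∃ σ : G.Coloring (Fin k), (colouringGraph G k t).Reachable τ σ ∧ σ v = j

/-- Thawed means `1`-thawed. -/
def IsThawed {V : Type*} [Fintype V] {G : SimpleGraph V} {k : ℕ}
    (τ : G.Coloring (Fin k)) (v : V) : Prop :=
  IsThawedAt 1 τ v

/-- The probability that a uniformly random proper `k`-colouring of the finite graph `G` has the
property `P` (the value is `0` if `G` has no proper `k`-colouring). -/
noncomputable def colouringProb {V : Type*} [Fintype V] (G : SimpleGraph V) (k : ℕ)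
    (P : G.Coloring (Fin k) → Prop) : ℝ :=
  (Nat.card {σ : G.Coloring (Fin k) // P σ} : ℝ) / (Nat.card (G.Coloring (Fin k)) : ℝ)

/-! Everything rests on a local count (`mul_card_properOn_le_insert`). In a triangle-free graph
whose degrees are at most about $(1-\varepsilon)k\ln k$, colouring one more vertex multiplies the
number of proper colourings by at least $l=k^{\varepsilon/4}$. By induction, few neighbours of the
new vertex have short lists of free colours. Re-randomising the independent neighbourhood inside its
lists then leaves roughly $ke^{-\Delta/k}$ colours unused on average.

This growth yields probability bounds (`pow_mul_card_filter_le`): an event that ignores the colours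
of $U$ and leaves each vertex of $U$ at most $b$ free colours has probability at most $(b/l)^{|U|}$.

By the girth, the ball of radius $d=q+2$ about $v$ is a tree. If no neighbour of $v$ is frozen, a
cascade of recolourings moving away from $v$ dies out inside the ball and gives $v$ any prescribed
colour (`exists_recolouring`). A frozen vertex has at least $m=k-2$ frozen children, so a frozen
neighbour of $v$ forces $m^q$ frozen vertices on level $d-1$. These cost $(2/l)^{m^q}$, while
choosing them costs only powers of $y=6\ln k$ per vertex, so the probability is at most $e^{-m^q}$
(`IsTreeLevel.card_frozen_le`). Taking $m^q\ge 2\ln n$ beats the union bound over edges, while the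
ball still has at most $(\ln n)^2$ vertices. -/

open Finset

/-! ### Counting proper colourings by extending them vertex by vertex -/

section Counting

variable {V : Type*} [Fintype V] [DecidableEq V] {k : ℕ}

open Classical in
/-- The maps `V → Fin k` that are proper colourings on the vertex set `W`; they are arbitrary
outside `W`. -/
noncomputable def properOn (G : SimpleGraph V) (k : ℕ) (W : Finset V) : Finset (V → Fin k) :=
  univ.filter fun f => ∀ x ∈ W, ∀ y ∈ W, G.Adj x y → f x ≠ f y

open Classical in
/-- The colours that `f` does not use on the neighbours of `v` in `W`. -/
noncomputable def freeColours (G : SimpleGraph V) (W : Finset V) (f : V → Fin k) (v : V) :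
    Finset (Fin k) :=
  univ.filter fun c => ∀ u ∈ W, G.Adj v u → f u ≠ c

variable {G : SimpleGraph V} {W : Finset V}

theorem mem_properOn {f : V → Fin k} :
    f ∈ properOn G k W ↔ ∀ x ∈ W, ∀ y ∈ W, G.Adj x y → f x ≠ f y := by
  simp [properOn]

theorem mem_freeColours {f : V → Fin k} {v : V} {c : Fin k} :
    c ∈ freeColours G W f v ↔ ∀ u ∈ W, G.Adj v u → f u ≠ c := by
  simp [freeColours]

theorem freeColours_anti {W' : Finset V} (h : W ⊆ W') (f : V → Fin k) (v : V) :
    freeColours G W' f v ⊆ freeColours G W f v :=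
  fun _ hc => mem_freeColours.2 fun u hu => mem_freeColours.1 hc u (h hu)

theorem freeColours_congr {f g : V → Fin k} {v : V}
    (h : ∀ u ∈ W, G.Adj v u → f u = g u) : freeColours G W f v = freeColours G W g v := by
  ext c
  simp only [mem_freeColours]
  refine forall_congr' fun u => forall_congr' fun hu => forall_congr' fun ha => ?_
  rw [h u hu ha]

theorem freeColours_erase (f : V → Fin k) (v : V) :
    freeColours G (W.erase v) f v = freeColours G W f v := by
  ext c
  simp only [mem_freeColours, mem_erase]
  exact ⟨fun h u hu ha => h u ⟨ha.ne', hu⟩ ha, fun h u hu ha => h u hu.2 ha⟩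

theorem mem_properOn_insert {v : V} {f : V → Fin k} :
    f ∈ properOn G k (insert v W) ↔ f ∈ properOn G k W ∧ f v ∈ freeColours G W f v := by
  simp only [mem_properOn, mem_freeColours, mem_insert]
  constructor
  · intro h
    exact ⟨fun x hx y hy => h x (.inr hx) y (.inr hy),
      fun u hu ha => (h v (.inl rfl) u (.inr hu) ha).symm⟩
  · rintro ⟨h1, h2⟩ x (rfl | hx) y (rfl | hy) ha
    · exact absurd rfl ha.ne
    · exact (h2 y hy ha).symm
    · exact h2 x hx ha.symm
    · exact h1 x hx y hy ha

theorem properOn_congr {f g : V → Fin k} (h : ∀ x ∈ W, f x = g x) :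
    f ∈ properOn G k W ↔ g ∈ properOn G k W := by
  simp only [mem_properOn]
  refine forall_congr' fun x => forall_congr' fun hx => forall_congr' fun y =>
    forall_congr' fun hy => forall_congr' fun ha => ?_
  rw [h x hx, h y hy]

theorem update_mem_properOn {v : V} (hv : v ∉ W) {f : V → Fin k} {c : Fin k} :
    Function.update f v c ∈ properOn G k W ↔ f ∈ properOn G k W :=
  properOn_congr fun x hx => Function.update_of_ne (by rintro rfl; exact hv hx) _ _

theorem freeColours_update {u v : V} (hv : v ∉ W) (f : V → Fin k) (c : Fin k) :
    freeColours G W (Function.update f v c) u = freeColours G W f u :=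
  freeColours_congr fun x hx _ => Function.update_of_ne (by rintro rfl; exact hv hx) _ _

open Classical in
/-- Extending a colouring to one more vertex: the event `Q` ignores the colour of that vertex. -/
theorem mul_card_properOn_insert {v : V} (hv : v ∉ W) (Q : (V → Fin k) → Prop)
    (hQ : ∀ f c, Q (Function.update f v c) ↔ Q f) :
    k * #{f ∈ properOn G k (insert v W) | Q f} =
      ∑ f ∈ properOn G k W with Q f, #(freeColours G W f v) := by
  have hprod : k * #{f ∈ properOn G k (insert v W) | Q f} =
      #({f ∈ properOn G k (insert v W) | Q f} ×ˢ (univ : Finset (Fin k))) := by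
    rw [card_product, card_univ, Fintype.card_fin, mul_comm]
  rw [← Finset.card_sigma, hprod]
  -- The bijection swaps the colour at `v` with the spare colour; `v` is uncoloured on the
  -- right-hand side, so its value there is arbitrary.
  refine Finset.card_nbij' (fun p => ⟨Function.update p.1 v p.2, p.1 v⟩)
    (fun p => (Function.update p.1 v p.2, p.1 v)) ?_ ?_ ?_ ?_
  · rintro ⟨f, c⟩ h
    simp only [coe_product, Set.mem_prod, mem_coe, mem_filter, mem_properOn_insert] at h
    simp only [coe_sigma, Set.mem_sigma_iff, mem_coe, mem_filter, update_mem_properOn hv, hQ,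
      freeColours_update hv]
    exact ⟨⟨h.1.1.1, h.1.2⟩, h.1.1.2⟩
  · rintro ⟨f, c⟩ h
    simp only [coe_sigma, Set.mem_sigma_iff, mem_coe, mem_filter] at h
    simp only [coe_product, Set.mem_prod, mem_coe, mem_filter, mem_properOn_insert,
      update_mem_properOn hv, hQ, freeColours_update hv, Function.update_self]
    exact ⟨⟨⟨h.1.1, h.2⟩, h.1.2⟩, mem_univ _⟩
  · rintro ⟨f, c⟩ h
    simp
  · rintro ⟨f, c⟩ h
    simp

open Classical in
-- Adding the vertices of `U` one at a time never offers more than `b` colours, since enlarging the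
-- coloured set only removes free colours.
theorem pow_mul_card_properOn_union_le {U : Finset V} (b : ℕ)
    (Q : (V → Fin k) → Prop) (hQ : ∀ u ∈ U, ∀ f c, Q (Function.update f u c) ↔ Q f)
    (hUW : Disjoint U W) (hb : ∀ f, Q f → ∀ u ∈ U, #(freeColours G W f u) ≤ b) :
    k ^ #U * #{f ∈ properOn G k (U ∪ W) | Q f} ≤ b ^ #U * #{f ∈ properOn G k W | Q f} := by
  induction U using Finset.induction_on with
  | empty => simp
  | insert v U hv ih =>
    rw [disjoint_insert_left] at hUW
    have hvW : v ∉ U ∪ W := by simp [hv, hUW.1]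
    have := ih (fun u hu => hQ u (mem_insert_of_mem hu)) hUW.2
      (fun f hf u hu => hb f hf u (mem_insert_of_mem hu))
    rw [card_insert_of_notMem hv, insert_union, pow_succ, mul_assoc,
      mul_card_properOn_insert hvW Q (hQ v (mem_insert_self _ _))]
    calc k ^ #U * ∑ f ∈ properOn G k (U ∪ W) with Q f, #(freeColours G (U ∪ W) f v)
        ≤ k ^ #U * (#{f ∈ properOn G k (U ∪ W) | Q f} * b) := by
          gcongr
          rw [← smul_eq_mul]
          refine Finset.sum_le_card_nsmul _ _ _ fun f hf => ?_
          exact (card_le_card (freeColours_anti subset_union_right f v)).trans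
            (hb f (mem_filter.1 hf).2 v (mem_insert_self _ _))
      _ = b * (k ^ #U * #{f ∈ properOn G k (U ∪ W) | Q f}) := by ring
      _ ≤ b * (b ^ #U * #{f ∈ properOn G k W | Q f}) := by gcongr
      _ = _ := by ring

theorem pow_mul_card_properOn_le {U : Finset V} {l : ℝ} (hl : 0 ≤ l)
    (h : ∀ W : Finset V, ∀ v, v ∉ W → l * #(properOn G k W) ≤ k * #(properOn G k (insert v W)))
    (hUW : Disjoint U W) :
    l ^ #U * #(properOn G k W) ≤ (k : ℝ) ^ #U * #(properOn G k (U ∪ W)) := by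
  induction U using Finset.induction_on with
  | empty => simp
  | insert v U hv ih =>
    rw [disjoint_insert_left] at hUW
    have hvW : v ∉ U ∪ W := by simp [hv, hUW.1]
    rw [card_insert_of_notMem hv, insert_union, pow_succ, pow_succ]
    calc l ^ #U * l * #(properOn G k W) = l * (l ^ #U * #(properOn G k W)) := by ring
      _ ≤ l * ((k : ℝ) ^ #U * #(properOn G k (U ∪ W))) := mul_le_mul_of_nonneg_left (ih hUW.2) hl
      _ = (k : ℝ) ^ #U * (l * #(properOn G k (U ∪ W))) := by ring
      _ ≤ (k : ℝ) ^ #U * (k * #(properOn G k (insert v (U ∪ W)))) := by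
        gcongr ?_ * ?_; exact h _ v hvW
      _ = _ := by ring

open Classical in
/-- If an event forces, for every vertex of `U`, at most `b` free colours, then it is unlikely. -/
theorem pow_mul_card_filter_le {U : Finset V} {l : ℝ} (hl : 0 ≤ l) (hk : 0 < k)
    (h : ∀ W : Finset V, ∀ v, v ∉ W → l * #(properOn G k W) ≤ k * #(properOn G k (insert v W)))
    (b : ℕ) (Q : (V → Fin k) → Prop) (hQ : ∀ u ∈ U, ∀ f c, Q (Function.update f u c) ↔ Q f)
    (hb : ∀ f, Q f → ∀ u ∈ U, #(freeColours G Uᶜ f u) ≤ b) :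
    l ^ #U * #{f ∈ properOn G k univ | Q f} ≤ (b : ℝ) ^ #U * #(properOn G k univ) := by
  -- Uncolour `U`. Under `Q` there are at most $b^{|U|}$ ways to colour it again, against at least
  -- $l^{|U|}$ on average without `Q`.
  have h1 := pow_mul_card_properOn_union_le b Q hQ disjoint_compl_right hb
  have h2 := pow_mul_card_properOn_le hl h (disjoint_compl_right (a := U))
  rw [union_compl] at h1 h2
  have h1' : (k : ℝ) ^ #U * #{f ∈ properOn G k univ | Q f} ≤
      (b : ℝ) ^ #U * #(properOn G k Uᶜ) := by
    have h1'' : (k : ℝ) ^ #U * #{f ∈ properOn G k univ | Q f} ≤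
        (b : ℝ) ^ #U * #{f ∈ properOn G k Uᶜ | Q f} := by exact_mod_cast h1
    refine h1''.trans ?_
    gcongr
    exact filter_subset _ _
  have hkU : (0 : ℝ) < (k : ℝ) ^ #U := by positivity
  refine le_of_mul_le_mul_left ?_ hkU
  calc (k : ℝ) ^ #U * (l ^ #U * #{f ∈ properOn G k univ | Q f})
      = l ^ #U * ((k : ℝ) ^ #U * #{f ∈ properOn G k univ | Q f}) := by ring
    _ ≤ l ^ #U * ((b : ℝ) ^ #U * #(properOn G k Uᶜ)) := by gcongr
    _ = (b : ℝ) ^ #U * (l ^ #U * #(properOn G k Uᶜ)) := by ring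
    _ ≤ (b : ℝ) ^ #U * ((k : ℝ) ^ #U * #(properOn G k univ)) := by gcongr
    _ = _ := by ring

open Classical in
-- Uncolour `u`: a colouring with a short list at `u` extends in at most `T` ways, the average one
-- in at least `l`. So a short list has probability at most $T/l$.
theorem card_small_freeColours_le {u : V} (hu : u ∈ W) {l : ℝ} (T : ℕ)
    (h : l * #(properOn G k (W.erase u)) ≤ k * #(properOn G k W)) (hl : 0 ≤ l) (hk : 0 < k) :
    l * #{f ∈ properOn G k W | #(freeColours G W f u) ≤ T} ≤ T * #(properOn G k W) := by
  have hA := mul_card_properOn_insert (G := G) (notMem_erase u W)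
    (fun f : V → Fin k => #(freeColours G (W.erase u) f u) ≤ T)
    (fun f c => by rw [freeColours_update (notMem_erase u W)])
  rw [insert_erase hu] at hA
  simp only [freeColours_erase] at hA
  have hB : k * #{f ∈ properOn G k W | #(freeColours G W f u) ≤ T} ≤
      T * #(properOn G k (W.erase u)) := by
    rw [hA, mul_comm T]
    refine (Finset.sum_le_card_nsmul _ _ T fun f hf => (mem_filter.1 hf).2).trans ?_
    rw [smul_eq_mul]
    gcongr
    exact filter_subset _ _
  have hB' : (k : ℝ) * #{f ∈ properOn G k W | #(freeColours G W f u) ≤ T} ≤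
      T * #(properOn G k (W.erase u)) := by exact_mod_cast hB
  have hk' : (0 : ℝ) < k := by exact_mod_cast hk
  refine le_of_mul_le_mul_left ?_ hk'
  nlinarith [mul_le_mul_of_nonneg_left hB' hl, mul_le_mul_of_nonneg_left h (Nat.cast_nonneg T : (0:ℝ) ≤ T)]

end Counting

/-! ### Expected number of unused colours for independent choices from lists -/

section ListEstimate

/-- For lists longer than `T`, replacing $1-1/a$ by an exponential costs only a factor $1+1/T$ in
the exponent. -/
theorem exp_neg_div_le_one_sub_inv {a T : ℝ} (hT : 0 < T) (ha : T + 1 ≤ a) :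
    Real.exp (-((1 + 1 / T) / a)) ≤ 1 - 1 / a := by
  have ha0 : 0 < a := by linarith
  have ha1 : 0 < a - 1 := by linarith
  have h1 : 1 / (a - 1) ≤ (1 + 1 / T) / a := by
    rw [div_le_div_iff₀ ha1 ha0, one_mul]
    have : (1 + 1 / T) * (a - 1) = a + (a - 1 - T) / T := by field_simp; ring
    rw [this]
    have : 0 ≤ (a - 1 - T) / T := div_nonneg (by linarith) hT.le
    linarith
  have h2 : a / (a - 1) ≤ Real.exp ((1 + 1 / T) / a) := by
    have := Real.add_one_le_exp ((1 + 1 / T) / a)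
    have h3 : a / (a - 1) = 1 / (a - 1) + 1 := by field_simp; ring
    rw [h3]; linarith
  rw [Real.exp_neg]
  have h4 : 1 - 1 / a = (a / (a - 1))⁻¹ := by field_simp
  rw [h4]
  exact inv_anti₀ (by positivity) h2

/-- The expected number of colours not used by independent uniform choices from the lists `L u`,
`u ∈ N`, when at most `s` of the lists have size at most `T`. -/
theorem sum_prod_one_sub_ge {V : Type*} [DecidableEq V] {k : ℕ} (N : Finset V)
    (L : V → Finset (Fin k)) {T : ℕ} (hT : 0 < T) {s D : ℝ}
    (hD : (#N : ℝ) ≤ D) (hs : (#{u ∈ N | #(L u) ≤ T} : ℝ) ≤ s)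
    (hκ : 0 < k - s * T) (hL : ∀ u ∈ N, (L u).Nonempty) :
    (k - s * T) * Real.exp (-((1 + 1 / T) * D / (k - s * T))) ≤
      ∑ c : Fin k, ∏ u ∈ N, (1 - if c ∈ L u then 1 / (#(L u) : ℝ) else 0) := by
  set κ := k - s * T with hκdef
  set A := (1 + 1 / (T : ℝ)) * D / κ with hA
  -- Colours occurring in a short list are given up; there are at most $sT$ of them.
  set X := {u ∈ N | #(L u) ≤ T}.biUnion L with hX
  have hTpos : (0 : ℝ) < T := by exact_mod_cast hT
  have hXcard : (#X : ℝ) ≤ s * T := by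
    have : #X ≤ #{u ∈ N | #(L u) ≤ T} * T :=
      card_biUnion_le_card_mul _ _ _ fun u hu => (mem_filter.1 hu).2
    calc (#X : ℝ) ≤ #{u ∈ N | #(L u) ≤ T} * T := by exact_mod_cast this
      _ ≤ s * T := by gcongr
  have hXc : κ ≤ #Xᶜ := by
    have h := card_add_card_compl X
    rw [Fintype.card_fin] at h
    have h' : (#X : ℝ) + #Xᶜ = k := by exact_mod_cast h
    linarith
  have hfac : ∀ c, ∀ u ∈ N, 0 ≤ 1 - (if c ∈ L u then 1 / (#(L u) : ℝ) else 0) := by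
    intro c u hu
    have : (1 : ℝ) ≤ #(L u) := by exact_mod_cast (hL u hu).card_pos
    split_ifs
    · have : 1 / (#(L u) : ℝ) ≤ 1 := by rw [div_le_one (by linarith)]; exact this
      linarith
    · norm_num
  set a : Fin k → ℝ := fun c =>
    (1 + 1 / (T : ℝ)) * ∑ u ∈ N, if c ∈ L u then 1 / (#(L u) : ℝ) else 0 with ha
  have hsum : ∑ c ∈ Xᶜ, a c ≤ (1 + 1 / (T : ℝ)) * D := by
    calc ∑ c ∈ Xᶜ, a c ≤ ∑ c, a c := by
          refine sum_le_sum_of_subset_of_nonneg (subset_univ _) fun c _ _ => ?_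
          refine mul_nonneg (by positivity) (sum_nonneg fun u _ => ?_)
          split_ifs <;> positivity
      _ = (1 + 1 / (T : ℝ)) * ∑ u ∈ N, 1 := by
          rw [ha, ← mul_sum, sum_comm]
          congr 1
          refine sum_congr rfl fun u hu => ?_
          have : (#(L u) : ℝ) ≠ 0 := by exact_mod_cast (hL u hu).card_pos.ne'
          rw [← sum_filter, sum_const, filter_mem_eq_inter, univ_inter, nsmul_eq_mul]
          field_simp
      _ ≤ _ := by
          simp only [sum_const, nsmul_eq_mul, mul_one]
          gcongr
  -- The tangent to $e^{-x}$ at $A$ plays the role of Jensen's inequality: the bound is linear in `a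
  -- c`, whose sum is controlled by `hsum`.
  have hprod : ∀ c ∈ Xᶜ, Real.exp (-A) * (1 - a c + A) ≤
      ∏ u ∈ N, (1 - if c ∈ L u then 1 / (#(L u) : ℝ) else 0) := by
    intro c hc
    have h1 : Real.exp (-A) * (1 - a c + A) ≤ Real.exp (-(a c)) := by
      have := Real.add_one_le_exp (A - a c)
      have h2 : Real.exp (-(a c)) = Real.exp (-A) * Real.exp (A - a c) := by
        rw [← Real.exp_add]; ring_nf
      rw [h2]
      gcongr
      linarith
    refine h1.trans ?_
    have h3 : -(a c) = ∑ u ∈ N, -((1 + 1 / (T : ℝ)) *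
        if c ∈ L u then 1 / (#(L u) : ℝ) else 0) := by
      rw [sum_neg_distrib, ← mul_sum]
    rw [h3, Real.exp_sum]
    refine prod_le_prod (fun _ _ => (Real.exp_pos _).le) fun u hu => ?_
    split_ifs with hcu
    · have hbig : T < #(L u) := by
        by_contra! hle
        exact (mem_compl.1 hc) (mem_biUnion.2 ⟨u, mem_filter.2 ⟨hu, hle⟩, hcu⟩)
      have := exp_neg_div_le_one_sub_inv (a := #(L u)) hTpos (by exact_mod_cast hbig)
      rwa [← mul_one_div] at this
    · simp
  calc κ * Real.exp (-A) = Real.exp (-A) * (κ * (1 + A) - (1 + 1 / (T : ℝ)) * D) := by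
        have : κ * A = (1 + 1 / (T : ℝ)) * D := by rw [hA]; field_simp
        rw [mul_add, this]; ring
    _ ≤ Real.exp (-A) * (#Xᶜ * (1 + A) - ∑ c ∈ Xᶜ, a c) := by
        have : 0 ≤ A := by
          have : 0 ≤ D := le_trans (Nat.cast_nonneg _) hD
          positivity
        gcongr
    _ = ∑ c ∈ Xᶜ, Real.exp (-A) * (1 - a c + A) := by
        rw [← mul_sum _ (fun c => 1 - a c + A), sum_add_distrib, sum_sub_distrib]
        simp only [sum_const, nsmul_eq_mul]
        ring
    _ ≤ ∑ c ∈ Xᶜ, ∏ u ∈ N, (1 - if c ∈ L u then 1 / (#(L u) : ℝ) else 0) := sum_le_sum hprod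
    _ ≤ _ := sum_le_sum_of_subset_of_nonneg (subset_univ _) fun c _ _ => prod_nonneg (hfac c)

end ListEstimate

/-! ### The extension ratio in triangle-free graphs -/

section Extension

variable {V : Type*} [Fintype V] [DecidableEq V] {k : ℕ} {G : SimpleGraph V} {W : Finset V}

open Classical in
/-- Resampling an independent set `N`: the colourings that agree with `f₀` off `N` form a product
of lists. -/
theorem filter_agree_eq_piFinset {N : Finset V} (hNW : N ⊆ W)
    (hN : ∀ x ∈ N, ∀ y ∈ N, ¬ G.Adj x y) {f₀ : V → Fin k} (hf₀ : f₀ ∈ properOn G k W) :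
    {f ∈ properOn G k W | ∀ x ∉ N, f x = f₀ x} =
      Fintype.piFinset fun x => if x ∈ N then freeColours G W f₀ x else {f₀ x} := by
  ext f
  simp only [mem_filter, Fintype.mem_piFinset, mem_properOn]
  constructor
  · rintro ⟨h1, h2⟩ x
    split_ifs with hx
    · rw [mem_freeColours]
      intro u hu ha
      rw [← h2 u fun huN => hN x hx u huN ha]
      exact (h1 x (hNW hx) u hu ha).symm
    · rw [mem_singleton, h2 x hx]
  · intro h
    have h2 : ∀ x ∉ N, f x = f₀ x := fun x hx => by
      have := h x; rw [if_neg hx] at this; exact mem_singleton.1 this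
    have h1 : ∀ x ∈ N, ∀ u ∈ W, G.Adj x u → f₀ u ≠ f x := fun x hx => by
      have := h x; rw [if_pos hx] at this; exact mem_freeColours.1 this
    refine ⟨fun x hx y hy ha => ?_, h2⟩
    by_cases hxN : x ∈ N
    · have hyN : y ∉ N := fun hyN => hN x hxN y hyN ha
      rw [h2 y hyN]; exact (h1 x hxN y hy ha).symm
    · by_cases hyN : y ∈ N
      · rw [h2 x hxN]; exact h1 y hyN x hx ha.symm
      · rw [h2 x hxN, h2 y hyN]; exact mem_properOn.1 hf₀ x hx y hy ha

theorem freeColours_nonempty {f : V → Fin k} (hf : f ∈ properOn G k W) {u : V} (hu : u ∈ W) :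
    (freeColours G W f u).Nonempty :=
  ⟨f u, mem_freeColours.2 fun w hw ha => (mem_properOn.1 hf u hu w hw ha).symm⟩

open Classical in
-- Once the colours off `N` are fixed, those on `N` are independent and uniform in their lists. The
-- product is the probability that all of `N` avoids `c`.
theorem sum_card_freeColours_fibre {N : Finset V} {v : V} (hN : N = {u ∈ W | G.Adj v u})
    (hNi : ∀ x ∈ N, ∀ y ∈ N, ¬ G.Adj x y) {f₀ : V → Fin k} (hf₀ : f₀ ∈ properOn G k W) :
    ∑ f ∈ properOn G k W with ∀ x ∉ N, f x = f₀ x, (#(freeColours G W f v) : ℝ) =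
      #{f ∈ properOn G k W | ∀ x ∉ N, f x = f₀ x} * ∑ c : Fin k, ∏ u ∈ N,
        (1 - if c ∈ freeColours G W f₀ u then 1 / (#(freeColours G W f₀ u) : ℝ) else 0) := by
  have hNW : N ⊆ W := by rw [hN]; exact filter_subset _ _
  have hne : ∀ u ∈ N, (#(freeColours G W f₀ u) : ℝ) ≠ 0 := fun u hu => by
    exact_mod_cast (freeColours_nonempty hf₀ (hNW hu)).card_pos.ne'
  rw [filter_agree_eq_piFinset hNW hNi hf₀]
  set L : V → Finset (Fin k) := fun x => if x ∈ N then freeColours G W f₀ x else {f₀ x} with hL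
  have hcount : ∀ c : Fin k, (#{f ∈ Fintype.piFinset L | c ∈ freeColours G W f v} : ℝ) =
      #(Fintype.piFinset L) * ∏ u ∈ N, (1 - if c ∈ freeColours G W f₀ u then
        1 / (#(freeColours G W f₀ u) : ℝ) else 0) := by
    intro c
    have : {f ∈ Fintype.piFinset L | c ∈ freeColours G W f v} =
        Fintype.piFinset fun x => if x ∈ N then (freeColours G W f₀ x).erase c else {f₀ x} := by
      ext f
      simp only [mem_filter, Fintype.mem_piFinset, hL]
      rw [mem_freeColours]
      constructor
      · rintro ⟨h1, h2⟩ x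
        have := h1 x
        split_ifs with hx
        · rw [if_pos hx] at this
          rw [hN, mem_filter] at hx
          exact mem_erase.2 ⟨h2 x hx.1 hx.2, this⟩
        · rwa [if_neg hx] at this
      · intro h
        refine ⟨fun x => ?_, fun u hu ha => ?_⟩
        · have := h x
          split_ifs with hx
          · rw [if_pos hx] at this; exact mem_of_mem_erase this
          · rwa [if_neg hx] at this
        · have := h u
          rw [if_pos (by rw [hN, mem_filter]; exact ⟨hu, ha⟩)] at this
          exact ne_of_mem_erase this
    rw [this, Fintype.card_piFinset, Fintype.card_piFinset]
    push_cast
    rw [← prod_subset (subset_univ N), ← prod_subset (subset_univ N), ← prod_mul_distrib]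
    · refine prod_congr rfl fun u hu => ?_
      simp only [hL, if_pos hu]
      have := hne u hu
      split_ifs with hc
      · rw [card_erase_of_mem hc, Nat.cast_sub (card_pos.2 ⟨c, hc⟩)]
        field_simp
        simp
      · rw [erase_eq_of_notMem hc]; simp
    · intro x _ hx; simp [hL, hx]
    · intro x _ hx; simp [hx]
  rw [mul_sum]
  simp_rw [← hcount]
  have : ∀ f : V → Fin k, (#(freeColours G W f v) : ℝ) =
      ∑ c : Fin k, if c ∈ freeColours G W f v then (1 : ℝ) else 0 := fun f => by simp
  simp_rw [this]
  rw [sum_comm]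
  refine sum_congr rfl fun c _ => ?_
  rw [sum_boole]

open Classical in
-- At least half of the colourings give few short lists around `v`; on these the list estimate
-- yields an average of `2 * l` free colours, and the others are bounded by zero.
theorem sum_card_freeColours_ge {v : V} {T : ℕ} (hT : 0 < T) {l D : ℝ} (hk : 0 < k)
    (hl : 0 < l) (hD0 : 0 < D) (hD : (#{u ∈ W | G.Adj v u} : ℝ) ≤ D)
    (htri : ∀ x y, G.Adj v x → G.Adj v y → ¬ G.Adj x y)
    (hκ : 0 < k - 2 * D * T / l * T)
    (hnum : 2 * l ≤ (k - 2 * D * T / l * T) *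
      Real.exp (-((1 + 1 / T) * D / (k - 2 * D * T / l * T))))
    (ih : ∀ u ∈ W, l * #(properOn G k (W.erase u)) ≤ k * #(properOn G k W)) :
    l * #(properOn G k W) ≤ ∑ f ∈ properOn G k W, (#(freeColours G W f v) : ℝ) := by
  set N := {u ∈ W | G.Adj v u} with hN
  set s := 2 * D * T / l with hs
  have hTpos : (0 : ℝ) < T := by exact_mod_cast hT
  have hspos : 0 < s := by positivity
  have hNW : N ⊆ W := filter_subset _ _
  have hNi : ∀ x ∈ N, ∀ y ∈ N, ¬ G.Adj x y := fun x hx y hy =>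
    htri x y (mem_filter.1 hx).2 (mem_filter.1 hy).2
  set small : (V → Fin k) → ℕ := fun f => #{u ∈ N | #(freeColours G W f u) ≤ T} with hsmall
  -- Markov's inequality: the expected number of short lists is at most $DT/l=s/2$.
  have hmarkov : 2 * (#{f ∈ properOn G k W | s < small f} : ℝ) ≤ #(properOn G k W) := by
    have h1 : s * #{f ∈ properOn G k W | s < small f} ≤ ∑ f ∈ properOn G k W, (small f : ℝ) := by
      calc s * (#{f ∈ properOn G k W | s < small f} : ℝ)
          = ∑ f ∈ properOn G k W with s < small f, s := by
            rw [sum_const, nsmul_eq_mul, mul_comm]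
        _ ≤ ∑ f ∈ properOn G k W with s < small f, (small f : ℝ) :=
            sum_le_sum fun f hf => (mem_filter.1 hf).2.le
        _ ≤ _ := sum_le_sum_of_subset_of_nonneg (filter_subset _ _) fun _ _ _ => Nat.cast_nonneg _
    have h2 : ∑ f ∈ properOn G k W, (small f : ℝ) =
        ∑ u ∈ N, (#{f ∈ properOn G k W | #(freeColours G W f u) ≤ T} : ℝ) := by
      simp only [hsmall, card_filter, Nat.cast_sum]
      rw [sum_comm]
    have h3 : l * ∑ f ∈ properOn G k W, (small f : ℝ) ≤ D * (T * #(properOn G k W)) := by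
      rw [h2, mul_sum]
      calc _ ≤ ∑ u ∈ N, (T * #(properOn G k W) : ℝ) := sum_le_sum fun u hu =>
            card_small_freeColours_le (hNW hu) T (ih u (hNW hu)) hl.le hk
        _ ≤ _ := by
            rw [sum_const, nsmul_eq_mul]
            gcongr
    have h4 : D * T * (2 * (#{f ∈ properOn G k W | s < small f} : ℝ)) ≤
        D * T * #(properOn G k W) := by
      have h5 := mul_le_mul_of_nonneg_left h1 hl.le
      have h6 : l * s = 2 * D * T := by rw [hs]; field_simp
      rw [← mul_assoc, h6] at h5
      linarith
    exact le_of_mul_le_mul_left h4 (by positivity)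
  have hgood : (#(properOn G k W) : ℝ) ≤ 2 * #{f ∈ properOn G k W | ¬ s < small f} := by
    have := card_filter_add_card_filter_not (s := properOn G k W) (fun f => s < small f)
    have h' : (#{f ∈ properOn G k W | s < small f} : ℝ) +
      #{f ∈ properOn G k W | ¬ s < small f} = #(properOn G k W) := by exact_mod_cast this
    linarith
  -- `r` forgets the colours on `N`. As `N` is independent, its lists, and hence `small`, are
  -- constant on the fibres of `r`.
  set r : (V → Fin k) → (V → Fin k) := fun f x => if x ∈ N then ⟨0, hk⟩ else f x with hr
  have hfib : ∀ f₀ ∈ properOn G k W,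
      ∑ f ∈ properOn G k W with r f = r f₀, (if s < small f then 0 else 2 * l) ≤
        ∑ f ∈ properOn G k W with r f = r f₀, (#(freeColours G W f v) : ℝ) := by
    intro f₀ hf₀
    have hrf : ∀ f, r f = r f₀ ↔ ∀ x ∉ N, f x = f₀ x := by
      intro f
      constructor
      · intro h x hx
        have := congrFun h x
        simpa [hr, hx] using this
      · intro h
        ext x
        by_cases hx : x ∈ N
        · simp [hr, hx]
        · simp [hr, hx, h x hx]
    simp_rw [hrf]
    have hsm : ∀ f ∈ {f ∈ properOn G k W | ∀ x ∉ N, f x = f₀ x}, small f = small f₀ := by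
      intro f hf
      simp only [hsmall]
      congr 1
      refine filter_congr fun u hu => ?_
      rw [freeColours_congr (f := f) (g := f₀)]
      intro w hw ha
      exact (mem_filter.1 hf).2 w fun hwN => hNi u hu w hwN ha
    rw [sum_congr rfl fun f hf => by rw [hsm f hf]]
    by_cases hb : s < small f₀
    · simp only [if_pos hb, sum_const_zero]
      exact sum_nonneg fun _ _ => Nat.cast_nonneg _
    · simp only [if_neg hb]
      rw [sum_card_freeColours_fibre hN hNi hf₀, sum_const, nsmul_eq_mul]
      gcongr
      exact hnum.trans (sum_prod_one_sub_ge N (freeColours G W f₀) hT hD (not_lt.1 hb) hκ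
        fun u hu => freeColours_nonempty hf₀ (hNW hu))
  calc l * (#(properOn G k W) : ℝ) ≤ l * (2 * #{f ∈ properOn G k W | ¬ s < small f}) := by gcongr
    _ = ∑ f ∈ properOn G k W, (if s < small f then 0 else 2 * l) := by
        rw [sum_ite, sum_const_zero, zero_add, sum_const, nsmul_eq_mul]; ring
    _ = ∑ g ∈ (properOn G k W).image r, ∑ f ∈ properOn G k W with r f = g,
          (if s < small f then 0 else 2 * l) :=
        (sum_fiberwise_of_maps_to (fun f hf => mem_image_of_mem r hf) _).symm
    _ ≤ ∑ g ∈ (properOn G k W).image r, ∑ f ∈ properOn G k W with r f = g,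
          (#(freeColours G W f v) : ℝ) := by
        refine sum_le_sum fun g hg => ?_
        obtain ⟨f₀, hf₀, rfl⟩ := mem_image.1 hg
        exact hfib f₀ hf₀
    _ = _ := sum_fiberwise_of_maps_to (fun f hf => mem_image_of_mem r hf) _

open Classical in
/-- In a triangle-free graph of bounded degree, colouring one more vertex multiplies the number of
proper colourings by at least `l`. -/
theorem mul_card_properOn_le_insert {T : ℕ} (hT : 0 < T) {l D : ℝ} (hk : 0 < k)
    (hl : 0 < l) (hD0 : 0 < D) (hD : ∀ v, (#{u | G.Adj v u} : ℝ) ≤ D)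
    (htri : ∀ v x y, G.Adj v x → G.Adj v y → ¬ G.Adj x y)
    (hκ : 0 < k - 2 * D * T / l * T)
    (hnum : 2 * l ≤ (k - 2 * D * T / l * T) *
      Real.exp (-((1 + 1 / T) * D / (k - 2 * D * T / l * T))))
    (W : Finset V) (v : V) (hv : v ∉ W) :
    l * #(properOn G k W) ≤ k * #(properOn G k (insert v W)) := by
  induction hn : #W using Nat.strong_induction_on generalizing W v with
  | _ n ih =>
    have h1 := mul_card_properOn_insert (G := G) (k := k) hv (fun _ => True) (by simp)
    simp only [filter_true] at h1
    have h2 : (k : ℝ) * #(properOn G k (insert v W)) =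
        ∑ f ∈ properOn G k W, (#(freeColours G W f v) : ℝ) := by exact_mod_cast h1
    rw [h2]
    refine sum_card_freeColours_ge hT hk hl hD0 ?_ (htri v) hκ hnum fun u hu => ?_
    · refine le_trans ?_ (hD v)
      gcongr
      exact subset_univ _
    · have := ih (#(W.erase u)) (by rw [← hn]; exact card_erase_lt_of_mem hu) (W.erase u) u
        (notMem_erase u W) rfl
      rwa [insert_erase hu] at this

end Extension

/-! ### Frozen vertices and recolouring cascades -/

section Recolouring

variable {V : Type*} {k : ℕ}

/-- `h` behaves, up to level `d`, like the distance from the root `v` of a tree. -/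
structure IsTreeLevel (G : SimpleGraph V) (h : V → ℕ) (v : V) (d : ℕ) : Prop where
  eq_zero_iff : ∀ x, h x = 0 ↔ x = v
  adj : ∀ u w, G.Adj u w → h u ≤ d → h w = h u + 1 ∨ h w + 1 = h u
  lower_unique : ∀ u p q, h u ≤ d → G.Adj u p → G.Adj u q → h p < h u → h q < h u → p = q
  exists_lower : ∀ u, 0 < h u → h u ≤ d → ∃ p, G.Adj u p ∧ h p + 1 = h u

/-- `u` is frozen to depth `r` in the colouring `f`, looking only at vertices of higher level:
every colour not used by `u` or its lower neighbours is used by an upper neighbour that is frozen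
to depth `r - 1`. -/
def IsFrozen (G : SimpleGraph V) (h : V → ℕ) (f : V → Fin k) : ℕ → V → Prop
  | 0, _ => True
  | r + 1, u => ∀ c, c ≠ f u → (∀ p, G.Adj u p → h p < h u → c ≠ f p) →
      ∃ w, G.Adj u w ∧ h u < h w ∧ f w = c ∧ IsFrozen G h f r w

variable [Fintype V] [DecidableEq V] {G : SimpleGraph V}

/-- Two colourings that differ on an independent set are connected by recolouring one vertex at a
time. -/
theorem reachable_of_indep (σ τ : G.Coloring (Fin k))
    (hind : ∀ x y, σ x ≠ τ x → σ y ≠ τ y → ¬ G.Adj x y) :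
    (colouringGraph G k 1).Reachable σ τ := by
  have hval : ∀ A : Finset V, ∀ {x y}, G.Adj x y →
      (if x ∈ A then τ x else σ x) ≠ if y ∈ A then τ y else σ y := by
    intro A x y ha
    have h1 := σ.valid ha
    have h2 := τ.valid ha
    by_cases hx : σ x = τ x
    · by_cases hy : y ∈ A
      · simp only [hy, hx, if_true, ite_self]; exact h2
      · simp only [hy, ← hx, if_false, ite_self]; exact h1
    · have hy : σ y = τ y := by
        by_contra hy
        exact hind x y hx hy ha
      by_cases hxA : x ∈ A
      · simp only [hxA, hy, if_true, ite_self]; exact h2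
      · simp only [hxA, ← hy, if_false, ite_self]; exact h1
  set ρ : Finset V → G.Coloring (Fin k) := fun A =>
    SimpleGraph.Coloring.mk (fun x => if x ∈ A then τ x else σ x) (hval A)
  have hρ : ∀ A x, ρ A x = if x ∈ A then τ x else σ x := fun _ _ => rfl
  have key : ∀ A, (colouringGraph G k 1).Reachable σ (ρ A) := by
    intro A
    induction A using Finset.induction_on with
    | empty =>
      have : ρ ∅ = σ := by
        ext x
        rw [hρ]; simp
      rw [this]
    | insert a A ha ih =>
      by_cases he : ρ A = ρ (insert a A)
      · rwa [← he]
      · refine ih.trans (SimpleGraph.Adj.reachable ⟨he, ?_⟩)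
        refine (card_le_card (t := {a}) fun x hx => ?_).trans_eq (card_singleton a)
        rw [mem_singleton]
        by_contra hxa
        apply (mem_filter.1 hx).2
        simp only [hρ, mem_insert, hxa, false_or]
  have : ρ univ = τ := by
    ext x
    rw [hρ]; simp
  rw [← this]
  exact key univ

variable {h : V → ℕ} {v : V} {d : ℕ}

/-- An unfrozen vertex has a new colour that only unfrozen upper neighbours can block. Giving `v`
the colour `j` pushes these conflicts upwards, and they stop below level `d` because every vertex is
frozen to depth 0. -/
theorem exists_recolouring (ht : IsTreeLevel G h v d) (hd : 0 < d) (σ : G.Coloring (Fin k))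
    (j : Fin k) (hj : j ≠ σ v) (hnf : ∀ u, G.Adj v u → ¬ IsFrozen G h σ (d - 1) u) :
    ∃ τ : G.Coloring (Fin k), τ v = j ∧ (∀ x, σ x ≠ τ x → h x < d) ∧
      (colouringGraph G k 1).Reachable σ τ := by
  classical
  have hv0 : h v = 0 := (ht.eq_zero_iff v).2 rfl
  have hc : ∀ u, ∃ c : Fin k, (u = v ∨ ¬ IsFrozen G h σ (d - h u) u) →
      (u = v → c = j) ∧ h u < d ∧ c ≠ σ u ∧ (∀ p, G.Adj u p → h p < h u → c ≠ σ p) ∧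
        ∀ w, G.Adj u w → h u < h w → σ w = c → ¬ IsFrozen G h σ (d - h w) w := by
    intro u
    by_cases huv : u = v
    · subst huv
      refine ⟨j, fun _ => ⟨fun _ => rfl, by omega, hj, fun p _ hp => by omega, fun w ha _ _ => ?_⟩⟩
      have : h w = 1 := by
        rcases ht.adj _ _ ha (by omega) with h | h <;> omega
      rw [this]
      exact hnf w ha
    · by_cases hf : IsFrozen G h σ (d - h u) u
      -- A dummy value: the cascade never reaches a frozen vertex.
      · exact ⟨σ u, fun h => absurd hf (h.resolve_left huv)⟩
      · have hlt : h u < d := by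
          by_contra hle
          rw [Nat.sub_eq_zero_of_le (by omega)] at hf
          exact hf trivial
        obtain ⟨r, hr⟩ : ∃ r, d - h u = r + 1 := ⟨d - h u - 1, by omega⟩
        have hf' := hf
        rw [hr, IsFrozen] at hf'
        push Not at hf'
        obtain ⟨c, hc1, hc2, hc3⟩ := hf'
        refine ⟨c, fun _ => ⟨fun h => absurd h huv, hlt, hc1, hc2, fun w ha hw hcw => ?_⟩⟩
        have : d - h w = r := by
          rcases ht.adj _ _ ha (by omega) with h | h <;> omega
        rw [this]
        exact hc3 w ha hw hcw
  choose c hc using hc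
  -- `R` is the cascade: the vertices forced to move, starting from `v`, because a moving lower
  -- neighbour takes their colour.
  obtain ⟨R, hRv, hRstep, hRcase⟩ : ∃ R : V → Prop, R v ∧
      (∀ u w, R u → G.Adj u w → h u < h w → σ w = c u → R w) ∧
      (∀ w, R w → (w = v ∨ ¬ IsFrozen G h σ (d - h w) w) ∧
        (w ≠ v → ∃ u, G.Adj u w ∧ h u < h w ∧ σ w = c u)) := by
    refine ⟨fun w => Relation.ReflTransGen
      (fun u w => G.Adj u w ∧ h u < h w ∧ σ w = c u) v w, .refl,
      fun u w hu h1 h2 h3 => hu.tail ⟨h1, h2, h3⟩, fun w hw => ?_⟩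
    induction hw with
    | refl => exact ⟨.inl rfl, fun h => absurd rfl h⟩
    | @tail u w _ hs ih =>
      exact ⟨.inr ((hc u ih.1).2.2.2.2 w hs.1 hs.2.1 hs.2.2), fun _ => ⟨u, hs⟩⟩
  have hR := fun u hu => hc u (hRcase u hu).1
  have hproper : ∀ i, ∀ {x y}, G.Adj x y →
      (if R x ∧ i ≤ h x then c x else σ x) ≠ if R y ∧ i ≤ h y then c y else σ y := by
    intro i
    -- If the upper vertex `y` also moves, uniqueness of its lower neighbour shows that `x` forced
    -- it, so `c x = σ y ≠ c y`. If it does not move, it does not have the colour `c x`.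
    have hup : ∀ x y, G.Adj x y → R x → i ≤ h x → h x < h y →
        c x ≠ if R y ∧ i ≤ h y then c y else σ y := by
      intro x y ha hx hix hlt
      have hxd := (hR x hx).2.1
      have hyd : h y ≤ d := by
        rcases ht.adj _ _ ha hxd.le with h | h <;> omega
      split_ifs with hy
      · have hyv : y ≠ v := by rintro rfl; omega
        obtain ⟨u, hu1, hu2, hu3⟩ := (hRcase y hy.1).2 hyv
        have hux := ht.lower_unique y u x hyd hu1.symm ha.symm hu2 hlt
        rw [← hux, ← hu3]
        exact (hR y hy.1).2.2.1.symm
      · intro hcx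
        refine hy ⟨hRstep x y hx ha hlt hcx.symm, ?_⟩
        omega
    have hlow : ∀ x y, G.Adj x y → R x → i ≤ h x →
        c x ≠ if R y ∧ i ≤ h y then c y else σ y := by
      intro x y ha hx hix
      rcases lt_or_ge (h x) (h y) with hlt | hge
      · exact hup x y ha hx hix hlt
      · have hlt : h y < h x := by
          rcases ht.adj _ _ ha (hR x hx).2.1.le with h | h <;> omega
        split_ifs with hy
        · have := hup y x ha.symm hy.1 hy.2 hlt
          rw [if_pos ⟨hx, hix⟩] at this
          exact this.symm
        · exact (hR x hx).2.2.2.1 y ha hlt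
    intro x y ha
    by_cases hx : R x ∧ i ≤ h x
    · rw [if_pos hx]; exact hlow x y ha hx.1 hx.2
    · by_cases hy : R y ∧ i ≤ h y
      · have := hlow y x ha.symm hy.1 hy.2
        rw [if_pos hy]; exact this.symm
      · rw [if_neg hx, if_neg hy]; exact σ.valid ha
  -- Only levels at least `i` have moved: lowering `i` recolours from the outside inwards, so
  -- blockers leave before they are needed. One level is an independent set.
  set τ : ℕ → G.Coloring (Fin k) := fun i =>
    SimpleGraph.Coloring.mk (fun x => if R x ∧ i ≤ h x then c x else σ x) (hproper i) with hτ
  have hτval : ∀ i x, τ i x = if R x ∧ i ≤ h x then c x else σ x := fun _ _ => rfl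
  have hreach : ∀ i, i ≤ d → (colouringGraph G k 1).Reachable σ (τ (d - i)) := by
    intro i
    induction i with
    | zero =>
      intro _
      have : τ (d - 0) = σ := by
        ext x
        rw [hτval, if_neg]
        rintro ⟨h1, h2⟩
        have := (hR x h1).2.1
        omega
      rw [this]
    | succ i ih =>
      intro hi
      refine (ih (by omega)).trans (reachable_of_indep _ _ ?_)
      have hlev : ∀ x, τ (d - i) x ≠ τ (d - (i + 1)) x → h x = d - (i + 1) := by
        intro x hx
        by_contra hne
        apply hx
        rw [hτval, hτval]
        have : d - i ≤ h x ↔ d - (i + 1) ≤ h x := by omega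
        simp only [this]
      intro x y hx hy ha
      have h1 := hlev x hx
      have h2 := hlev y hy
      rcases ht.adj x y ha (by omega) with h | h <;> omega
  refine ⟨τ 0, ?_, ?_, ?_⟩
  · rw [hτval, if_pos ⟨hRv, Nat.zero_le _⟩, (hR v hRv).1 rfl]
  · intro x hx
    by_contra hlt
    apply hx
    rw [hτval, if_neg]
    rintro ⟨h1, -⟩
    exact hlt (hR x h1).2.1
  · simpa using hreach d le_rfl

end Recolouring

/-! ### Large girth makes balls trees -/

section Levels

variable {V : Type*} {G : SimpleGraph V}

/-- The edges of two distinct paths with the same ends span a subgraph that is not a forest; a cycle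
in it uses each of these edges at most once. -/
theorem egirth_le_of_paths_ne {u w : V} {p q : G.Walk u w} (hp : p.IsPath) (hq : q.IsPath)
    (hne : p ≠ q) : G.egirth ≤ (p.length + q.length : ℕ) := by
  set H : SimpleGraph V := SimpleGraph.fromEdgeSet {e | e ∈ p.edges ∨ e ∈ q.edges} with hH
  have hedge : ∀ e, e ∈ G.edgeSet → (e ∈ p.edges ∨ e ∈ q.edges) → e ∈ H.edgeSet := by
    intro e he h
    rw [hH, SimpleGraph.edgeSet_fromEdgeSet]
    exact ⟨h, G.not_isDiag_of_mem_edgeSet he⟩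
  have hpH : ∀ e ∈ p.edges, e ∈ H.edgeSet := fun e he =>
    hedge e (p.edges_subset_edgeSet he) (.inl he)
  have hqH : ∀ e ∈ q.edges, e ∈ H.edgeSet := fun e he =>
    hedge e (q.edges_subset_edgeSet he) (.inr he)
  have hcyc : ¬ H.IsAcyclic := by
    intro hac
    have hsub := SimpleGraph.isAcyclic_iff_subsingleton_path.1 hac u w
    have heq := congrArg Subtype.val (Subsingleton.elim
      (⟨p.transfer H hpH, hp.transfer hpH⟩ : H.Path u w) ⟨q.transfer H hqH, hq.transfer hqH⟩)
    apply hne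
    apply SimpleGraph.Walk.ext_support
    have := congrArg SimpleGraph.Walk.support heq
    simpa using this
  simp only [SimpleGraph.IsAcyclic, not_forall, not_not] at hcyc
  obtain ⟨a, c, hc⟩ := hcyc
  have hcmem : ∀ e ∈ c.edges, e ∈ p.edges ∨ e ∈ q.edges := by
    intro e he
    have := c.edges_subset_edgeSet he
    rw [hH, SimpleGraph.edgeSet_fromEdgeSet] at this
    exact this.1
  have hcG : ∀ e ∈ c.edges, e ∈ G.edgeSet := fun e he =>
    (hcmem e he).elim (fun h => p.edges_subset_edgeSet h) fun h => q.edges_subset_edgeSet h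
  refine (SimpleGraph.egirth_le_length (hc.transfer hcG)).trans ?_
  rw [SimpleGraph.Walk.length_transfer]
  have hsub : c.edges ⊆ p.edges ++ q.edges := fun e he => by
    rw [List.mem_append]; exact hcmem e he
  have := (hc.isCircuit.isTrail.edges_nodup.subperm hsub).length_le
  rw [List.length_append, SimpleGraph.Walk.length_edges, SimpleGraph.Walk.length_edges,
    SimpleGraph.Walk.length_edges] at this
  exact_mod_cast this

/-- A shortest path to `a` cannot pass through `u`, which is no closer to `v`. -/
theorem exists_path_concat_of_dist_le {v a u : V} (ha : G.Adj a u) (hr : G.Reachable v a)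
    (hd : G.dist v a ≤ G.dist v u) :
    ∃ p : G.Walk v u, p.IsPath ∧ p.length = G.dist v a + 1 ∧ p.penultimate = a := by
  classical
  obtain ⟨p, hp, hl⟩ := hr.exists_path_of_dist
  refine ⟨p.concat ha, hp.concat (fun hu => ?_) ha, by simp [hl], p.penultimate_concat ha⟩
  have h1 := p.length_takeUntil_lt_length hu ha.ne'
  have h2 := SimpleGraph.dist_le (p.takeUntil u hu)
  omega

theorem egirth_le_of_two_neighbours {v u a b : V} (ha : G.Adj a u) (hb : G.Adj b u) (hab : a ≠ b)
    (hr : G.Reachable v u) (hda : G.dist v a ≤ G.dist v u) (hdb : G.dist v b ≤ G.dist v u) :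
    G.egirth ≤ (2 * G.dist v u + 2 : ℕ) := by
  obtain ⟨p, hp, hpl, hpa⟩ := exists_path_concat_of_dist_le ha (hr.trans ha.symm.reachable) hda
  obtain ⟨q, hq, hql, hqb⟩ := exists_path_concat_of_dist_le hb (hr.trans hb.symm.reachable) hdb
  refine (egirth_le_of_paths_ne hp hq ?_).trans ?_
  · rintro rfl
    exact hab (hpa.symm.trans hqb)
  · exact_mod_cast (by omega)

open Classical in
/-- The distance from `v`, with value `d + 1` on the other components. -/
noncomputable def level (G : SimpleGraph V) (d : ℕ) (v x : V) : ℕ :=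
  if G.Reachable v x then G.dist v x else d + 1

theorem level_comm (d : ℕ) (v x : V) : level G d v x = level G d x v := by
  unfold level
  rw [SimpleGraph.dist_comm, SimpleGraph.reachable_comm]

theorem exists_adj_dist_add_one {v u : V} (hr : G.Reachable v u) (h : 0 < G.dist v u) :
    ∃ p, G.Adj u p ∧ G.dist v p + 1 = G.dist v u := by
  obtain ⟨w, hw⟩ := hr.symm.exists_walk_length_eq_dist
  rw [SimpleGraph.dist_comm] at hw
  cases w with
  | nil => simp at h
  | @cons _ p _ ha q =>
    refine ⟨p, ha, ?_⟩
    rw [SimpleGraph.Walk.length_cons] at hw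
    have h1 := SimpleGraph.dist_le q
    rw [SimpleGraph.dist_comm] at h1
    rcases ha.diff_dist_adj (u := v) with h | h | h <;> omega

theorem isTreeLevel_level (d : ℕ) (v : V)
    (hg : ((2 * d + 2 : ℕ) : ℕ∞) < G.egirth) : IsTreeLevel G (level G d v) v d := by
  -- This is the purpose of the value `d + 1`: `dist` alone is 0 on the other components.
  have hreach : ∀ {u}, level G d v u ≤ d → G.Reachable v u := by
    intro u hu
    by_contra hr
    rw [level, if_neg hr] at hu
    omega
  have hlev : ∀ {u}, G.Reachable v u → level G d v u = G.dist v u := fun hr => if_pos hr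
  -- An edge inside a level and a second lower neighbour are excluded alike: each gives `u` two
  -- neighbours no farther from `v`, hence a cycle of length at most $2d+2$.
  have hbad : ∀ {u a b}, G.Adj u a → G.Adj u b → a ≠ b → level G d v u ≤ d →
      G.dist v a ≤ G.dist v u → G.dist v b ≤ G.dist v u → False := by
    intro u a b ha hb hab hu h1 h2
    have hr := hreach hu
    have := egirth_le_of_two_neighbours ha.symm hb.symm hab hr h1 h2
    rw [hlev hr] at hu
    have h3 : ((2 * G.dist v u + 2 : ℕ) : ℕ∞) ≤ ((2 * d + 2 : ℕ) : ℕ∞) := by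
      exact_mod_cast (by omega)
    exact absurd (this.trans h3) (not_le.2 hg)
  refine ⟨fun x => ?_, fun u w ha hu => ?_, fun u p q hu hp hq hlp hlq => ?_, fun u h0 hu => ?_⟩
  · by_cases hr : G.Reachable v x
    · rw [hlev hr, hr.dist_eq_zero_iff, eq_comm]
    · rw [level, if_neg hr]
      refine ⟨fun h => by omega, ?_⟩
      rintro rfl
      exact absurd (SimpleGraph.Reachable.refl _) hr
  · have hr := hreach hu
    have hrw := hr.trans ha.reachable
    rw [hlev hr, hlev hrw]
    by_cases heq : G.dist v w = G.dist v u
    · exfalso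
      by_cases h0 : G.dist v u = 0
      · rw [h0] at heq
        rw [hr.dist_eq_zero_iff] at h0
        rw [hrw.dist_eq_zero_iff] at heq
        exact ha.ne (h0.symm.trans heq)
      · obtain ⟨p, hp, hpd⟩ := exists_adj_dist_add_one hr (Nat.pos_of_ne_zero h0)
        refine hbad ha hp ?_ hu heq.le (by omega)
        rintro rfl
        omega
    · have hne : G.dist v u ≠ 0 ∨ G.dist v w = G.dist v u + 1 := by
        rcases ha.diff_dist_adj (u := v) with h | h | h <;> omega
      rcases ha.diff_dist_adj (u := v) with h | h | h <;> omega
  · by_contra hpq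
    have hr := hreach hu
    rw [hlev hr, hlev (hr.trans hp.reachable)] at hlp
    rw [hlev hr, hlev (hr.trans hq.reachable)] at hlq
    exact hbad hp hq hpq hu hlp.le hlq.le
  · have hr := hreach hu
    rw [hlev hr] at h0 ⊢
    obtain ⟨p, hp, hpd⟩ := exists_adj_dist_add_one hr h0
    exact ⟨p, hp, by rw [hlev (hr.trans hp.reachable)]; exact hpd⟩

theorem not_adj_of_egirth (hg : (3 : ℕ∞) < G.egirth) (v x y : V) (hx : G.Adj v x)
    (hy : G.Adj v y) : ¬ G.Adj x y := by
  intro hxy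
  have hp : (SimpleGraph.Walk.cons hx .nil).IsPath := by simp [hx.ne]
  have hq : (SimpleGraph.Walk.cons hy (.cons hxy.symm .nil)).IsPath := by
    simp [hx.ne, hy.ne, hxy.ne']
  have := egirth_le_of_paths_ne hp hq (by
    intro h
    have := congrArg SimpleGraph.Walk.length h
    simp at this)
  simp only [SimpleGraph.Walk.length_cons, SimpleGraph.Walk.length_nil] at this
  exact absurd (this.trans_eq (by norm_num)) (not_le.2 hg)

open Classical in
theorem IsTreeLevel.card_le [Fintype V] [DecidableEq V] {h : V → ℕ} {v : V} {d : ℕ}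
    (ht : IsTreeLevel G h v d) {B : ℕ} (hB : ∀ x, #{u | G.Adj x u} ≤ B) (i : ℕ) (hi : i ≤ d) :
    #{x | h x ≤ i} ≤ (B + 1) ^ i := by
  induction i with
  | zero =>
    have : ({x | h x ≤ 0} : Finset V) = {v} := by
      ext x; simp [ht.eq_zero_iff]
    rw [this]; simp
  | succ i ih =>
    have hsub : ({x | h x ≤ i + 1} : Finset V) ⊆
        ({x | h x ≤ i} : Finset V).biUnion fun x => insert x ({u | G.Adj x u} : Finset V) := by
      intro x hx
      rw [mem_filter] at hx
      rw [mem_biUnion]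
      by_cases hle : h x ≤ i
      · exact ⟨x, by simpa using hle, mem_insert_self _ _⟩
      · obtain ⟨p, hp, hpd⟩ := ht.exists_lower x (by omega) (by omega)
        exact ⟨p, by simp; omega, by simp [hp.symm]⟩
    refine (card_le_card hsub).trans ((card_biUnion_le_card_mul _ _ (B + 1) fun x _ => ?_).trans ?_)
    · exact (card_insert_le _ _).trans (Nat.add_le_add_right (hB x) 1)
    · rw [pow_succ]
      exact Nat.mul_le_mul_right _ (ih (by omega))

end Levels

/-- This is $\binom nb\le(en/b)^b$, which follows from $b^b/b!\le e^b$. -/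
theorem choose_le_pow_of_exp_mul_le {n b : ℕ} {y : ℝ} (h : Real.exp 1 * n ≤ y * b) :
    (n.choose b : ℝ) ≤ y ^ b := by
  rcases Nat.eq_zero_or_pos b with rfl | hb
  · simp
  have hb' : (0 : ℝ) < b := by exact_mod_cast hb
  have h1 : (n.choose b : ℝ) ≤ (n : ℝ) ^ b / b.factorial := Nat.choose_le_pow_div b n
  have h2 : (b : ℝ) ^ b / b.factorial ≤ Real.exp b := Real.pow_div_factorial_le_exp _ hb'.le b
  have h3 : Real.exp b = Real.exp 1 ^ b := by rw [← Real.exp_nat_mul, mul_one]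
  have hbb : (0 : ℝ) < (b : ℝ) ^ b := by positivity
  refine h1.trans (le_of_mul_le_mul_left ?_ hbb)
  calc (b : ℝ) ^ b * ((n : ℝ) ^ b / b.factorial)
      = (b : ℝ) ^ b / b.factorial * (n : ℝ) ^ b := by ring
    _ ≤ Real.exp 1 ^ b * (n : ℝ) ^ b := by rw [← h3]; gcongr
    _ = (Real.exp 1 * n) ^ b := by rw [mul_pow]
    _ ≤ (y * b) ^ b := by gcongr
    _ = (b : ℝ) ^ b * y ^ b := by rw [mul_pow]; ring

/-! ### Frozen sets are doubly exponentially unlikely -/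

section FrozenCount

variable {V : Type*} [Fintype V] {k : ℕ} {G : SimpleGraph V} {h : V → ℕ} {v : V} {d : ℕ}

theorem IsTreeLevel.exists_blocked_colours (ht : IsTreeLevel G h v d) (f : V → Fin k) {u : V}
    (hu : h u ≤ d) : ∃ S : Finset (Fin k), #S ≤ 2 ∧
      ∀ c ∉ S, c ≠ f u ∧ ∀ p, G.Adj u p → h p < h u → c ≠ f p := by
  by_cases hp : ∃ p, G.Adj u p ∧ h p < h u
  · obtain ⟨p, hp1, hp2⟩ := hp
    refine ⟨{f u, f p}, card_le_two, fun c hc => ?_⟩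
    simp only [mem_insert, mem_singleton, not_or] at hc
    refine ⟨hc.1, fun q hq1 hq2 => ?_⟩
    rw [ht.lower_unique u q p hu hq1 hp1 hq2 hp2]
    exact hc.2
  · refine ⟨{f u}, by simp, fun c hc => ⟨by simpa using hc, fun p h1 h2 => absurd ⟨p, h1, h2⟩ hp⟩⟩

variable [DecidableEq V]

open Classical in
-- Freezing on level `d - 1` means that level `d` already uses all but two colours, those of the
-- vertex and of its parent. This weaker event ignores the colours of `U`, so
-- `pow_mul_card_filter_le` applies with `b = 2`.
theorem IsTreeLevel.card_frozen_one_le (ht : IsTreeLevel G h v d) {l : ℝ} (hl : 0 ≤ l)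
    (hk : 0 < k) (hext : ∀ W : Finset V, ∀ v, v ∉ W →
      l * #(properOn G k W) ≤ k * #(properOn G k (insert v W)))
    (U : Finset V) (hU : ∀ u ∈ U, h u + 1 = d) :
    l ^ #U * #{f ∈ properOn G k univ | ∀ u ∈ U, IsFrozen G h f 1 u} ≤
      2 ^ #U * #(properOn G k univ) := by
  set X : Finset V := {x | h x = d} with hX
  have hUX : ∀ u ∈ U, u ∉ X := fun u hu hx => by
    have h1 := hU u hu
    have h2 : h u = d := by simpa [hX] using hx
    omega
  have key := pow_mul_card_filter_le hl hk hext 2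
    (U := U) (fun f : V → Fin k => ∀ u ∈ U, #(freeColours G X f u) ≤ 2)
    (fun u hu f c => by simp only [freeColours_update (hUX u hu)])
    (fun f hf u hu => (card_le_card (freeColours_anti (fun x hx =>
      mem_compl.2 fun hxU => hUX x hxU hx) f u)).trans (hf u hu))
  refine le_trans ?_ (key.trans_eq (by norm_num))
  gcongr with f _ u hu
  intro hf
  have hud := hU u hu
  obtain ⟨S, hS2, hS⟩ := ht.exists_blocked_colours f (u := u) (by omega)
  refine (card_le_card fun c hc => ?_).trans hS2
  by_contra hcS
  obtain ⟨w, hw1, hw2, hw3, -⟩ := hf c (hS c hcS).1 (hS c hcS).2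
  refine mem_freeColours.1 hc w ?_ hw1 hw3
  have := ht.adj u w hw1 (by omega)
  simp only [hX, mem_filter, mem_univ, true_and]
  omega

open Classical in
-- Each of at least $k-2$ colours has its own frozen child, and different vertices share no child in
-- a tree.
theorem IsTreeLevel.card_frozen_children_ge (ht : IsTreeLevel G h v d) (f : V → Fin k) {r : ℕ}
    (U : Finset V) (hU : ∀ u ∈ U, h u < d) (hf : ∀ u ∈ U, IsFrozen G h f (r + 1) u) :
    (k - 2) * #U ≤
      #{w ∈ U.biUnion fun u => {w | G.Adj u w ∧ h u < h w} | IsFrozen G h f r w} := by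
  rw [filter_biUnion, card_biUnion]
  · rw [mul_comm, ← smul_eq_mul]
    refine card_nsmul_le_sum _ _ _ fun u hu => ?_
    obtain ⟨S, hS2, hS⟩ := ht.exists_blocked_colours f (hU u hu).le
    have h1 : k - 2 ≤ #Sᶜ := by
      rw [card_compl, Fintype.card_fin]; omega
    refine h1.trans ((card_le_card (t := image f _) fun c hc => ?_).trans card_image_le)
    have hcS := hS c (mem_compl.1 hc)
    obtain ⟨w, hw1, hw2, hw3, hw4⟩ := hf u hu c hcS.1 hcS.2
    exact mem_image.2 ⟨w, by simp [hw1, hw2, hw4], hw3⟩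
  · intro u hu u' hu' hne
    rw [Function.onFun, disjoint_left]
    intro w hw hw'
    simp only [mem_filter, mem_univ, true_and] at hw hw'
    refine hne (ht.lower_unique w u u' ?_ hw.1.1.symm hw'.1.1.symm hw.1.2 hw'.1.2)
    have := hU u hu
    rcases ht.adj u w hw.1.1 this.le with h | h <;> omega

open Classical in
/-- The number of colourings in which all vertices of a set `U` on level `d - (r + 1)` are frozen to
depth `r + 1`. -/
theorem IsTreeLevel.card_frozen_le (ht : IsTreeLevel G h v d) {l D y : ℝ} (hl : 0 < l)
    (hk : 4 ≤ k) (hext : ∀ W : Finset V, ∀ v, v ∉ W →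
      l * #(properOn G k W) ≤ k * #(properOn G k (insert v W)))
    (hD : ∀ v, (#{u | G.Adj v u} : ℝ) ≤ D) (hy1 : 1 ≤ y)
    (hy : Real.exp 1 * D ≤ y * (k - 2 : ℕ)) (r : ℕ) (U : Finset V)
    (hU : ∀ u ∈ U, h u + (r + 1) = d) :
    (#{f ∈ properOn G k univ | ∀ u ∈ U, IsFrozen G h f (r + 1) u} : ℝ) ≤
      (1 / y ^ 2) ^ #U * (2 * y ^ 2 / l) ^ (#U * (k - 2) ^ r) * #(properOn G k univ) := by
  have hy0 : 0 < y := by linarith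
  induction r generalizing U with
  | zero =>
    have := ht.card_frozen_one_le hl.le (by omega) hext U (by simpa using hU)
    rw [pow_zero, mul_one, ← mul_pow]
    -- The leaf bound $2/l$ is split so that a reserve $y^{-2}$ per vertex is available to pay for
    -- the choice of frozen children.
    have h1 : 1 / y ^ 2 * (2 * y ^ 2 / l) = 2 / l := by field_simp
    rw [h1, div_pow, div_mul_eq_mul_div, le_div_iff₀ (by positivity), mul_comm]
    exact this
  | succ r ih =>
    set m := k - 2 with hm
    have hm2 : 2 ≤ m := by omega
    set C : Finset V := U.biUnion fun u => {w | G.Adj u w ∧ h u < h w} with hC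
    have hsub : {f ∈ properOn G k univ | ∀ u ∈ U, IsFrozen G h f (r + 1 + 1) u} ⊆
        (powersetCard (m * #U) C).biUnion fun A =>
          {f ∈ properOn G k univ | ∀ w ∈ A, IsFrozen G h f (r + 1) w} := by
      intro f hf
      rw [mem_filter] at hf
      have hge := ht.card_frozen_children_ge f U (fun u hu => by have := hU u hu; omega) hf.2
      obtain ⟨A, hA, hAc⟩ := exists_subset_card_eq hge
      rw [mem_biUnion]
      refine ⟨A, mem_powersetCard.2 ⟨hA.trans (filter_subset _ _), hAc⟩, mem_filter.2 ⟨hf.1, ?_⟩⟩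
      exact fun w hw => (mem_filter.1 (hA hw)).2
    have hCcard : (#C : ℝ) ≤ D * #U := by
      calc (#C : ℝ) ≤ ∑ u ∈ U, (#{w | G.Adj u w ∧ h u < h w} : ℝ) := by
            exact_mod_cast card_biUnion_le
        _ ≤ ∑ u ∈ U, D := by
            refine sum_le_sum fun u _ => le_trans ?_ (hD u)
            gcongr with w
            exact fun h => h.1
        _ = _ := by rw [sum_const, nsmul_eq_mul, mul_comm]
    have hchoose : ((#C).choose (m * #U) : ℝ) ≤ y ^ (m * #U) := by
      apply choose_le_pow_of_exp_mul_le
      push_cast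
      calc Real.exp 1 * (#C : ℝ) ≤ Real.exp 1 * (D * #U) := by gcongr
        _ = Real.exp 1 * D * #U := by ring
        _ ≤ y * m * #U := by gcongr
        _ = _ := by ring
    have hA : ∀ A ∈ powersetCard (m * #U) C,
        (#{f ∈ properOn G k univ | ∀ w ∈ A, IsFrozen G h f (r + 1) w} : ℝ) ≤
          (1 / y ^ 2) ^ (m * #U) * (2 * y ^ 2 / l) ^ (#U * m ^ (r + 1)) *
            #(properOn G k univ) := by
      intro A hA
      rw [mem_powersetCard] at hA
      have := ih A fun w hw => by
        obtain ⟨u, hu, hw'⟩ := mem_biUnion.1 (hA.1 hw)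
        simp only [mem_filter, mem_univ, true_and] at hw'
        have h1 := hU u hu
        rcases ht.adj u w hw'.1 (by omega) with h | h <;> omega
      rw [hA.2] at this
      refine this.trans_eq ?_
      congr 3
      ring
    have h1 : (#{f ∈ properOn G k univ | ∀ u ∈ U, IsFrozen G h f (r + 1 + 1) u} : ℝ) ≤
        ((#C).choose (m * #U) : ℝ) * ((1 / y ^ 2) ^ (m * #U) *
          (2 * y ^ 2 / l) ^ (#U * m ^ (r + 1)) * #(properOn G k univ)) := by
      calc _ ≤ ∑ A ∈ powersetCard (m * #U) C,
            (#{f ∈ properOn G k univ | ∀ w ∈ A, IsFrozen G h f (r + 1) w} : ℝ) := by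
            exact_mod_cast (card_le_card hsub).trans card_biUnion_le
        _ ≤ _ := by
            refine (sum_le_sum hA).trans_eq ?_
            rw [sum_const, nsmul_eq_mul, card_powersetCard]
    refine h1.trans ?_
    rw [← mul_assoc, ← mul_assoc]
    gcongr ?_ * _ * _
    -- The children's reserve pays $y$ per child for the choice; the remaining $y^{-m|U|}$ restores
    -- the reserve of `U`, since $m\ge2$.
    calc ((#C).choose (m * #U) : ℝ) * (1 / y ^ 2) ^ (m * #U)
        ≤ y ^ (m * #U) * (1 / y ^ 2) ^ (m * #U) := by gcongr
      _ = (1 / y) ^ (m * #U) := by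
          rw [← mul_pow]; congr 1; field_simp
      _ ≤ (1 / y) ^ (2 * #U) := by
          apply pow_le_pow_of_le_one (by positivity)
          · rw [div_le_one hy0]; exact hy1
          · gcongr
      _ = (1 / y ^ 2) ^ #U := by rw [pow_mul]; congr 1; field_simp

end FrozenCount

/-! ### From counts to probabilities -/

section Probability

variable {V : Type*} [Fintype V] [DecidableEq V] {k : ℕ} {G : SimpleGraph V}

/-- Proper colourings of `G` as a finite set of maps. -/
noncomputable def coloringEquivProperOn (G : SimpleGraph V) (k : ℕ) :
    G.Coloring (Fin k) ≃ properOn G k univ where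
  toFun σ := ⟨σ, mem_properOn.2 fun _ _ _ _ ha => σ.valid ha⟩
  invFun f := SimpleGraph.Coloring.mk f.1 fun {x y} ha =>
    mem_properOn.1 f.2 x (mem_univ x) y (mem_univ y) ha
  left_inv _ := rfl
  right_inv _ := rfl

open Classical in
theorem one_sub_le_colouringProb {P : G.Coloring (Fin k) → Prop} {bad : (V → Fin k) → Prop}
    (hP : ∀ σ : G.Coloring (Fin k), ¬ bad σ → P σ) (hpos : 0 < #(properOn G k univ)) {δ : ℝ}
    (hbad : (#{f ∈ properOn G k univ | bad f} : ℝ) ≤ δ * #(properOn G k univ)) :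
    1 - δ ≤ colouringProb G k P := by
  have h1 : Nat.card (G.Coloring (Fin k)) = #(properOn G k univ) := by
    rw [Nat.card_congr (coloringEquivProperOn G k), Nat.card_eq_fintype_card, Fintype.card_coe]
  have hfin : Finite (G.Coloring (Fin k)) := Finite.of_equiv _ (coloringEquivProperOn G k).symm
  have h2 : #{f ∈ properOn G k univ | ¬ bad f} ≤ Nat.card {σ : G.Coloring (Fin k) // P σ} := by
    rw [← Fintype.card_coe, ← Nat.card_eq_fintype_card]
    refine Nat.card_le_card_of_injective (fun f =>
      ⟨(coloringEquivProperOn G k).symm ⟨f.1, (mem_filter.1 f.2).1⟩,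
        hP _ (mem_filter.1 f.2).2⟩) fun f g hfg => ?_
    have := (coloringEquivProperOn G k).symm.injective (congrArg Subtype.val hfg)
    exact Subtype.ext (Subtype.mk.inj this)
  have h3 := card_filter_add_card_filter_not (s := properOn G k univ) bad
  have h3' : (#{f ∈ properOn G k univ | bad f} : ℝ) + #{f ∈ properOn G k univ | ¬ bad f} =
      #(properOn G k univ) := by exact_mod_cast h3
  have h2' : (#{f ∈ properOn G k univ | ¬ bad f} : ℝ) ≤
      Nat.card {σ : G.Coloring (Fin k) // P σ} := by exact_mod_cast h2
  have hpos' : (0 : ℝ) < #(properOn G k univ) := by exact_mod_cast hpos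
  rw [colouringProb, h1, le_div_iff₀ hpos']
  linarith

open Classical in
/-- If no neighbour of any vertex is frozen, then every vertex is loose and thawed. -/
theorem isLoose_and_isThawed_of_not_frozen {d B t : ℕ} (hd : 0 < d) (hk : 2 ≤ k)
    (hg : ((2 * d + 2 : ℕ) : ℕ∞) < G.egirth) (hB : ∀ x, #{u | G.Adj x u} ≤ B)
    (ht : (B + 1) ^ d ≤ t) (htn : t < Fintype.card V) (σ : G.Coloring (Fin k))
    (hnf : ∀ v u, G.Adj v u → ¬ IsFrozen G (level G d v) σ (d - 1) u) (v : V) :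
    IsLoose t σ v ∧ IsThawed σ v := by
  have htree := fun v => isTreeLevel_level (G := G) d v hg
  have hball : ∀ v, #{x | level G d v x ≤ d} ≤ t := fun v =>
    ((htree v).card_le hB d le_rfl).trans ht
  have hrec := fun v j hj => exists_recolouring (htree v) hd σ j hj (hnf v)
  have hdist : ∀ v (τ : G.Coloring (Fin k)), (∀ x, σ x ≠ τ x → level G d v x < d) →
      hammingDist (fun v => σ v) (fun v => τ v) ≤ t := fun v τ hτ =>
    (card_le_card fun x hx => by
      rw [mem_filter] at hx ⊢
      exact ⟨mem_univ x, (hτ x hx.2).le⟩).trans (hball v)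
  refine ⟨fun j => ?_, fun j => ?_⟩
  -- Adjacency in the colouring graph requires a different colouring even when `v` keeps its colour.
  -- So a vertex `v'` outside the ball is recoloured, and its cascade does not reach `v`.
  · by_cases hj : j = σ v
    · obtain ⟨v', hv'⟩ : ∃ v', d < level G d v v' := by
        by_contra! hall
        have : ({x | level G d v x ≤ d} : Finset V) = univ := by
          ext x; simp [hall x]
        have h2 := hball v
        rw [this, card_univ] at h2
        omega
      have : Nontrivial (Fin k) := Fin.nontrivial_iff_two_le.2 hk
      obtain ⟨j', hj'⟩ := exists_ne (σ v')
      obtain ⟨τ, h1, h2, -⟩ := hrec v' j' hj'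
      refine ⟨τ, ⟨?_, hdist v' τ h2⟩, ?_⟩
      · rintro rfl
        exact hj' h1.symm
      · rw [hj]
        by_contra hne
        have := h2 v (Ne.symm hne)
        rw [level_comm] at this
        omega
    · obtain ⟨τ, h1, h2, -⟩ := hrec v j hj
      refine ⟨τ, ⟨?_, hdist v τ h2⟩, h1⟩
      rintro rfl
      exact hj h1.symm
  · by_cases hj : j = σ v
    · exact ⟨σ, .refl _, hj.symm⟩
    · obtain ⟨τ, h1, -, h3⟩ := hrec v j hj
      exact ⟨τ, h3, h1⟩

open Classical in
-- A union bound over ordered adjacent pairs; `u` lies on level 1, which is $d-(q+1)$ for $d=q+2$.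
theorem card_exists_frozen_le {q : ℕ} {l D y : ℝ} (hl : 0 < l) (hk : 4 ≤ k)
    (hext : ∀ W : Finset V, ∀ v, v ∉ W →
      l * #(properOn G k W) ≤ k * #(properOn G k (insert v W)))
    (hD : ∀ v, (#{u | G.Adj v u} : ℝ) ≤ D) (hy1 : 1 ≤ y)
    (hy : Real.exp 1 * D ≤ y * (k - 2 : ℕ)) (hz : 2 * y ^ 2 / l ≤ Real.exp (-1))
    (hg : ((2 * (q + 2) + 2 : ℕ) : ℕ∞) < G.egirth) :
    (#{f ∈ properOn G k univ | ∃ v u, G.Adj v u ∧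
        IsFrozen G (level G (q + 2) v) f (q + 1) u} : ℝ) ≤
      Fintype.card V * (D * (Real.exp (-((k - 2 : ℕ) : ℝ) ^ q) * #(properOn G k univ))) := by
  have hy0 : 0 < y := by linarith
  have hone : ∀ v u, G.Adj v u →
      (#{f ∈ properOn G k univ | IsFrozen G (level G (q + 2) v) f (q + 1) u} : ℝ) ≤
        Real.exp (-((k - 2 : ℕ) : ℝ) ^ q) * #(properOn G k univ) := by
    intro v u hvu
    have ht := isTreeLevel_level (G := G) (q + 2) v hg
    have hv0 := (ht.eq_zero_iff v).2 rfl
    have hu1 : level G (q + 2) v u = 1 := by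
      rcases ht.adj v u hvu (by omega) with h | h <;> omega
    have := ht.card_frozen_le hl hk hext hD hy1 hy q {u} (by
      intro x hx
      rw [mem_singleton.1 hx, hu1]; omega)
    simp only [mem_singleton, forall_eq, card_singleton, pow_one, one_mul] at this
    refine this.trans ?_
    gcongr
    calc 1 / y ^ 2 * (2 * y ^ 2 / l) ^ (k - 2) ^ q ≤ 1 * Real.exp (-1) ^ (k - 2) ^ q := by
          gcongr
          rw [div_le_one (by positivity)]
          exact one_le_pow₀ hy1
      _ = Real.exp (-((k - 2 : ℕ) : ℝ) ^ q) := by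
          rw [one_mul, ← Real.exp_nat_mul]
          push_cast
          ring_nf
  have hsub : {f ∈ properOn G k univ | ∃ v u, G.Adj v u ∧
      IsFrozen G (level G (q + 2) v) f (q + 1) u} ⊆ univ.biUnion fun v =>
        ({u | G.Adj v u} : Finset V).biUnion fun u =>
          {f ∈ properOn G k univ | IsFrozen G (level G (q + 2) v) f (q + 1) u} := by
    intro f hf
    obtain ⟨hfp, v, u, hvu, hfr⟩ := mem_filter.1 hf
    exact mem_biUnion.2 ⟨v, mem_univ v, mem_biUnion.2 ⟨u, by simpa using hvu,
      mem_filter.2 ⟨hfp, hfr⟩⟩⟩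
  calc _ ≤ ∑ v : V, ∑ u ∈ ({u | G.Adj v u} : Finset V),
        (#{f ∈ properOn G k univ | IsFrozen G (level G (q + 2) v) f (q + 1) u} : ℝ) := by
        exact_mod_cast (card_le_card hsub).trans
          (card_biUnion_le.trans (sum_le_sum fun v _ => card_biUnion_le))
    _ ≤ ∑ v : V, ∑ u ∈ ({u | G.Adj v u} : Finset V),
        (Real.exp (-((k - 2 : ℕ) : ℝ) ^ q) * #(properOn G k univ)) :=
        sum_le_sum fun v _ => sum_le_sum fun u hu => hone v u (by simpa using hu)
    _ ≤ ∑ v : V, D * (Real.exp (-((k - 2 : ℕ) : ℝ) ^ q) * #(properOn G k univ)) := by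
        refine sum_le_sum fun v _ => ?_
        rw [sum_const, nsmul_eq_mul]
        gcongr
        exact hD v
    _ = _ := by rw [sum_const, nsmul_eq_mul, card_univ]

theorem properOn_univ_card_pos {l : ℝ} (hl : 0 < l) (hk : 0 < k)
    (hext : ∀ W : Finset V, ∀ v, v ∉ W →
      l * #(properOn G k W) ≤ k * #(properOn G k (insert v W))) :
    0 < #(properOn G k univ) := by
  have h := pow_mul_card_properOn_le hl.le hext (disjoint_empty_right univ)
  rw [union_empty] at h
  have h0 : 0 < #(properOn G k ∅) :=
    card_pos.2 ⟨fun _ => ⟨0, hk⟩, mem_properOn.2 fun x hx => absurd hx (notMem_empty x)⟩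
  have h1 : (0 : ℝ) < l ^ #(univ : Finset V) * #(properOn G k ∅) := by positivity
  by_contra hz
  rw [Nat.eq_zero_of_not_pos hz] at h
  simp only [Nat.cast_zero, mul_zero] at h
  linarith

end Probability

/-! ### Choice of parameters -/

section Asymptotics

open Filter

theorem exists_colour_threshold {ε : ℝ} (hε : 0 < ε) (hε2 : ε ≤ 1 / 2) :
    ∃ T : ℕ, 0 < T ∧ ∃ k₀ : ℕ, ∀ k : ℕ, k₀ ≤ k → ∃ l D y : ℝ, 0 < l ∧ 4 ≤ k ∧
      D = (1 - ε) * k * Real.log k ∧ 0 < D ∧ 0 < k - 2 * D * T / l * T ∧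
      2 * l ≤ (k - 2 * D * T / l * T) *
        Real.exp (-((1 + 1 / T) * D / (k - 2 * D * T / l * T))) ∧
      1 ≤ y ∧ Real.exp 1 * D ≤ y * (k - 2 : ℕ) ∧ 2 * y ^ 2 / l ≤ Real.exp (-1) ∧
      16 ≤ Real.log (k - 2 : ℕ) ∧ (D + 1) ^ 2 ≤ ((k - 2 : ℕ) : ℝ) ^ 3 := by
  set T := ⌈8 / ε⌉₊ with hT
  have hTpos : 0 < T := Nat.ceil_pos.2 (by positivity)
  have hTr : (0 : ℝ) < T := by exact_mod_cast hTpos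
  have hTinv : 1 / (T : ℝ) ≤ ε / 8 := by
    rw [div_le_div_iff₀ hTr (by norm_num)]
    have := Nat.le_ceil (8 / ε)
    rw [← hT, div_le_iff₀ hε] at this
    linarith
  have hcast := tendsto_natCast_atTop_atTop (R := ℝ)
  have e1 : ∀ᶠ k : ℕ in atTop, Real.log k ≤ ε / (16 * T ^ 2) * (k : ℝ) ^ (ε / 4) := by
    have := ((isLittleO_log_rpow_atTop (show 0 < ε / 4 by positivity)).bound
      (show 0 < ε / (16 * (T : ℝ) ^ 2) by positivity))
    filter_upwards [hcast.eventually this] with k hk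
    refine (le_abs_self _).trans (hk.trans_eq ?_)
    rw [Real.norm_of_nonneg (by positivity)]
  have e2 : ∀ᶠ k : ℕ in atTop, Real.log k ≤ 1 / 15 * (k : ℝ) ^ (ε / 8) := by
    have := ((isLittleO_log_rpow_atTop (show 0 < ε / 8 by positivity)).bound
      (show (0 : ℝ) < 1 / 15 by norm_num))
    filter_upwards [hcast.eventually this] with k hk
    refine (le_abs_self _).trans (hk.trans_eq ?_)
    rw [Real.norm_of_nonneg (by positivity)]
  have e3 : ∀ᶠ k : ℕ in atTop, 32 * Real.log k ^ 2 ≤ k := by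
    have := ((Real.isLittleO_pow_log_id_atTop (n := 2)).bound
      (show (0 : ℝ) < 1 / 32 by norm_num))
    filter_upwards [hcast.eventually this] with k hk
    rw [Real.norm_of_nonneg (by positivity), id, Real.norm_of_nonneg (by positivity)] at hk
    linarith
  have e4 : ∀ᶠ k : ℕ in atTop, 4 ≤ (k : ℝ) ^ (ε / 4) :=
    ((tendsto_rpow_atTop (show 0 < ε / 4 by positivity)).comp hcast).eventually_ge_atTop 4
  have e5 : ∀ᶠ k : ℕ in atTop, 2 * Real.exp 16 ≤ k := hcast.eventually_ge_atTop _
  obtain ⟨k₀, hk₀⟩ := eventually_atTop.1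
    (e1.and (e2.and (e3.and (e4.and (e5.and (eventually_ge_atTop 4))))))
  refine ⟨T, hTpos, k₀, fun k hk => ?_⟩
  obtain ⟨h1, h2, h3, h4, h5, hk4⟩ := hk₀ k hk
  have hkr : (4 : ℝ) ≤ k := by exact_mod_cast hk4
  have hk0 : (0 : ℝ) < k := by linarith
  have hm : ((k - 2 : ℕ) : ℝ) = k - 2 := by
    rw [Nat.cast_sub (by omega)]; norm_num
  have hlog : 16 ≤ Real.log (k - 2 : ℕ) := by
    rw [hm, Real.le_log_iff_exp_le (by linarith)]
    linarith
  have hlog16 : 16 ≤ Real.log k :=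
    hlog.trans (Real.log_le_log (by rw [hm]; linarith) (by rw [hm]; linarith))
  set l := (k : ℝ) ^ (ε / 4) with hl
  set D := (1 - ε) * k * Real.log k with hD
  have hlpos : 0 < l := by positivity
  have hDpos : 0 < D := by
    have : 0 < 1 - ε := by linarith
    positivity
  have hDle : D ≤ k * Real.log k := by
    have : 0 ≤ k * Real.log k := by positivity
    rw [hD, mul_assoc]; nlinarith
  set κ := k - 2 * D * T / l * T with hκ
  have hκge : (1 - ε / 8) * k ≤ κ := by
    have : 2 * D * T / l * T ≤ ε / 8 * k := by
      rw [div_mul_eq_mul_div, div_le_iff₀ hlpos]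
      calc 2 * D * T * T ≤ 2 * (k * Real.log k) * T * T := by gcongr
        _ ≤ 2 * (k * (ε / (16 * T ^ 2) * l)) * T * T := by gcongr
        _ = ε / 8 * k * l := by field_simp; ring
    rw [hκ]; linarith
  have hκhalf : k / 2 ≤ κ := by nlinarith
  have hκpos : 0 < κ := by linarith
  have hexp : (1 + 1 / (T : ℝ)) * D / κ ≤ (1 - ε / 2) * Real.log k := by
    rw [div_le_iff₀ hκpos]
    calc (1 + 1 / (T : ℝ)) * D ≤ (1 + ε / 8) * D := by gcongr
      _ = ((1 + ε / 8) * (1 - ε)) * (k * Real.log k) := by rw [hD]; ring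
      _ ≤ ((1 - ε / 2) * (1 - ε / 8)) * (k * Real.log k) := by
          gcongr ?_ * _
          nlinarith
      _ = (1 - ε / 2) * Real.log k * ((1 - ε / 8) * k) := by ring
      _ ≤ (1 - ε / 2) * Real.log k * κ := by
          have : 0 ≤ (1 - ε / 2) * Real.log k := mul_nonneg (by linarith) (by linarith)
          gcongr
  refine ⟨l, D, 6 * Real.log k, hlpos, hk4, rfl, hDpos, hκpos, ?_, by linarith, ?_, ?_, hlog, ?_⟩
  · calc 2 * l ≤ k / 2 * Real.exp (-((1 - ε / 2) * Real.log k)) := by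
          -- The list estimate gives at least $k^{\varepsilon/2}/2=l^2/2$ free colours, which is at
          -- least $2l$ because $l\ge4$.
          have h6 : (k : ℝ) * Real.exp (-((1 - ε / 2) * Real.log k)) = l * l := by
            rw [hl, ← Real.rpow_add hk0]
            nth_rewrite 1 [← Real.exp_log hk0]
            rw [← Real.exp_add, Real.rpow_def_of_pos hk0]
            congr 1; ring
          have h7 : k / 2 * Real.exp (-((1 - ε / 2) * Real.log k)) = l * l / 2 := by
            rw [← h6]; ring
          rw [h7]; nlinarith
      _ ≤ κ * Real.exp (-((1 + 1 / (T : ℝ)) * D / κ)) := by gcongr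
  · rw [hm]
    have he : Real.exp 1 < 3 := Real.exp_one_lt_three
    calc Real.exp 1 * D ≤ 3 * (k * Real.log k) := by gcongr
      _ ≤ 6 * Real.log k * (k - 2) := by nlinarith
  · rw [Real.exp_neg, div_le_iff₀ hlpos]
    have he : Real.exp 1 < 3 := Real.exp_one_lt_three
    have hsq : Real.log k ^ 2 ≤ 1 / 225 * l := by
      calc Real.log k ^ 2 ≤ (1 / 15 * (k : ℝ) ^ (ε / 8)) ^ 2 := by gcongr
        _ = 1 / 225 * l := by
          rw [mul_pow, ← Real.rpow_mul_natCast hk0.le, hl]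
          norm_num
          ring_nf
    have hinv : 1 / 3 ≤ (Real.exp 1)⁻¹ := by
      rw [one_div]; exact inv_anti₀ (Real.exp_pos 1) he.le
    calc 2 * (6 * Real.log k) ^ 2 = 72 * Real.log k ^ 2 := by ring
      _ ≤ 72 * (1 / 225 * l) := by gcongr
      _ ≤ 1 / 3 * l := by nlinarith
      _ ≤ _ := by gcongr
  · rw [hm]
    have h8 : D + 1 ≤ 2 * (k * Real.log k) := by
      have : 1 ≤ k * Real.log k := one_le_mul_of_one_le_of_one_le (by linarith) (by linarith)
      linarith
    calc (D + 1) ^ 2 ≤ (2 * (k * Real.log k)) ^ 2 := by gcongr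
      _ = (k : ℝ) ^ 2 * (32 * Real.log k ^ 2) / 8 := by ring
      _ ≤ (k : ℝ) ^ 2 * k / 8 := by gcongr
      _ = (k / 2 : ℝ) ^ 3 := by ring
      _ ≤ _ := by gcongr; linarith

/-- Take $q=\lceil\log_m(2\ln n)\rceil$. The ball has at most $(B+1)^{q+2}\le m^{3(q+2)/2}=O_m((\ln
n)^{3/2})$ vertices, and $\ln m\ge16$ keeps $2q+6$ below $\ln\ln n$. -/
theorem exists_depth {m B : ℕ} (hm : 16 ≤ Real.log m) (hB : (B + 1) ^ 2 ≤ m ^ 3) (D : ℝ) {δ : ℝ}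
    (hδ : 0 < δ) : ∃ N : ℕ, ∀ n : ℕ, N ≤ n → ∃ q : ℕ, 0 < n ∧ 2 * Real.log n ≤ (m : ℝ) ^ q ∧
      2 * (q + 2) + 2 < ⌈Real.log (Real.log n)⌉₊ ∧
      (B + 1) ^ (q + 2) ≤ ⌊1 * Real.log n ^ 2⌋₊ ∧ ⌊1 * Real.log n ^ 2⌋₊ < n ∧ D ≤ δ * n := by
  have hcast := tendsto_natCast_atTop_atTop (R := ℝ)
  have hlogt := Real.tendsto_log_atTop.comp hcast
  have hloglog := Real.tendsto_log_atTop.comp hlogt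
  have hm0 : (0 : ℝ) < m := by
    rcases Nat.eq_zero_or_pos m with rfl | h
    · norm_num at hm
    · exact_mod_cast h
  have e3 : ∀ᶠ n : ℕ in atTop, 2 * Real.log n ^ 2 ≤ n := by
    have := ((Real.isLittleO_pow_log_id_atTop (n := 2)).bound
      (show (0 : ℝ) < 1 / 2 by norm_num))
    filter_upwards [hcast.eventually this] with k hk
    rw [Real.norm_of_nonneg (by positivity), id, Real.norm_of_nonneg (by positivity)] at hk
    linarith
  obtain ⟨N, hN⟩ := eventually_atTop.1 ((hloglog.eventually_ge_atTop 20).and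
    ((hlogt.eventually_ge_atTop (8 * (m : ℝ) ^ 9 + 1)).and (e3.and
      ((hcast.eventually_ge_atTop (D / δ)).and (eventually_gt_atTop 0)))))
  refine ⟨N, fun n hn => ?_⟩
  obtain ⟨h1, h2, h3, h4, h5⟩ := hN n hn
  simp only [Function.comp_apply] at h1 h2
  set L := Real.log n with hL
  have hL1 : 1 ≤ L := by
    have : 0 < 8 * (m : ℝ) ^ 9 := by positivity
    linarith
  have hlm : 0 < Real.log m := by linarith
  set x := Real.log (2 * L) / Real.log m with hx
  have hlog2L : Real.log (2 * L) = Real.log 2 + Real.log L :=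
    Real.log_mul (by norm_num) (by linarith)
  have hlog2 : Real.log 2 < 1 := by linarith [Real.log_two_lt_d9]
  have hlog2' : 0 < Real.log 2 := Real.log_pos (by norm_num)
  have hx0 : 0 ≤ x := div_nonneg (by linarith) hlm.le
  have hq1 : x ≤ (⌈x⌉₊ : ℝ) := Nat.le_ceil x
  have hq2 : (⌈x⌉₊ : ℝ) < x + 1 := Nat.ceil_lt_add_one hx0
  have hmq : (m : ℝ) ^ ⌈x⌉₊ = Real.exp (⌈x⌉₊ * Real.log m) := by
    rw [Real.exp_nat_mul, Real.exp_log hm0]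
  have hxm : x * Real.log m = Real.log (2 * L) := by rw [hx]; field_simp
  have hupper : (m : ℝ) ^ ⌈x⌉₊ ≤ 2 * L * m := by
    rw [hmq]
    calc Real.exp (⌈x⌉₊ * Real.log m) ≤ Real.exp ((x + 1) * Real.log m) := by gcongr
      _ = 2 * L * m := by
        rw [add_mul, one_mul, hxm, Real.exp_add, Real.exp_log (by linarith), Real.exp_log hm0]
  refine ⟨⌈x⌉₊, h5, ?_, ?_, ?_, ?_, ?_⟩
  · rw [hmq]
    calc 2 * L = Real.exp (x * Real.log m) := by rw [hxm, Real.exp_log (by linarith)]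
      _ ≤ _ := by gcongr
  · rw [Nat.lt_ceil]
    push_cast
    have hx16 : x ≤ (Real.log L + 1) / 16 := by
      rw [hx, hlog2L, div_le_div_iff₀ hlm (by norm_num)]
      nlinarith
    linarith
  · apply Nat.le_floor
    rw [one_mul]
    have hBr : ((B : ℝ) + 1) ^ 2 ≤ (m : ℝ) ^ 3 := by exact_mod_cast hB
    push_cast
    refine le_of_sq_le_sq ?_ (by positivity)
    calc (((B : ℝ) + 1) ^ (⌈x⌉₊ + 2)) ^ 2 = (((B : ℝ) + 1) ^ 2) ^ (⌈x⌉₊ + 2) := by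
          rw [← pow_mul, ← pow_mul, mul_comm]
      _ ≤ ((m : ℝ) ^ 3) ^ (⌈x⌉₊ + 2) := by gcongr
      _ = ((m : ℝ) ^ ⌈x⌉₊) ^ 3 * m ^ 6 := by ring
      _ ≤ (2 * L * m) ^ 3 * m ^ 6 := by gcongr
      _ = 8 * (m : ℝ) ^ 9 * L ^ 3 := by ring
      _ ≤ L * L ^ 3 := by gcongr; linarith
      _ = (L ^ 2) ^ 2 := by ring
  · rw [Nat.floor_lt (by positivity), one_mul]
    have : 0 < L ^ 2 := by positivity
    linarith
  · rw [div_le_iff₀ hδ] at h4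
    linarith

end Asymptotics

/-! ### Assembly -/

theorem mainTheorem4 :
    ∃ C : ℝ, 0 < C ∧ ∀ ε : ℝ, 0 < ε → ∃ k₀ : ℕ, ∀ k : ℕ, k₀ ≤ k →
      ∀ Δ : ℕ, (Δ : ℝ) ≤ (1 - ε) * k * Real.log k →
        ∀ δ : ℝ, 0 < δ → ∃ N : ℕ, ∀ n : ℕ, N ≤ n →
          ∀ (G : SimpleGraph (Fin n)) [DecidableRel G.Adj],
            G.maxDegree ≤ Δ →
            (⌈Real.log (Real.log n)⌉₊ : ℕ∞) ≤ G.egirth →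
            1 - δ ≤ colouringProb G k (fun σ => ∀ v : Fin n,
              IsLoose ⌊C * (Real.log n) ^ 2⌋₊ σ v ∧ IsThawed σ v) := by
  classical
  refine ⟨1, one_pos, fun ε hε => ?_⟩
  -- Capping ε only weakens the degree bound and keeps `D` positive.
  obtain ⟨T, hT, k₀, hk₀⟩ := exists_colour_threshold (ε := min ε (1 / 2))
    (lt_min hε (by norm_num)) (min_le_right _ _)
  refine ⟨k₀, fun k hk Δ hΔ δ hδ => ?_⟩
  obtain ⟨l, D, y, hl, hk4, hDdef, hD0, hκ, hnum, hy1, hy, hz, hm, hDm⟩ := hk₀ k hk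
  have hkr : (4 : ℝ) ≤ k := by exact_mod_cast hk4
  have hΔD : (Δ : ℝ) ≤ D := by
    refine hΔ.trans ?_
    have : 0 ≤ Real.log k := Real.log_nonneg (by linarith)
    rw [hDdef]
    gcongr
    exact min_le_left _ _
  obtain ⟨N, hN⟩ := exists_depth (B := Δ) hm (by
    have : ((Δ : ℝ) + 1) ^ 2 ≤ ((k - 2 : ℕ) : ℝ) ^ 3 := le_trans (by gcongr) hDm
    exact_mod_cast this) D hδ
  refine ⟨N, fun n hn G inst hdeg hgirth => ?_⟩
  obtain rfl : inst = fun _ _ => Classical.propDecidable _ := Subsingleton.elim _ _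
  obtain ⟨q, hn0, hq, hqg, hball, htn, hDn⟩ := hN n hn
  have hg : ((2 * (q + 2) + 2 : ℕ) : ℕ∞) < G.egirth :=
    lt_of_lt_of_le (by exact_mod_cast hqg) hgirth
  have hB : ∀ x, #{u | G.Adj x u} ≤ Δ := fun x => by
    have h1 : #{u | G.Adj x u} = G.degree x := by
      rw [← G.card_neighborFinset_eq_degree]
      congr 1
      ext u
      simp
    rw [h1]
    exact (G.degree_le_maxDegree x).trans hdeg
  have hDdeg : ∀ x, (#{u | G.Adj x u} : ℝ) ≤ D := fun x =>
    le_trans (by exact_mod_cast hB x) hΔD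
  have htri := not_adj_of_egirth (lt_of_le_of_lt (by
    have : 3 ≤ 2 * (q + 2) + 2 := by omega
    exact_mod_cast this) hg)
  have hext := mul_card_properOn_le_insert (k := k) hT (by omega) hl hD0 hDdeg htri hκ hnum
  refine one_sub_le_colouringProb (bad := fun f => ∃ v u, G.Adj v u ∧
    IsFrozen G (level G (q + 2) v) f (q + 1) u) (fun σ hσ v => ?_)
    (properOn_univ_card_pos hl (by omega) hext) ?_
  · refine isLoose_and_isThawed_of_not_frozen (d := q + 2) (by omega) (by omega) hg hB hball
      (by simpa using htn) σ (fun v u hvu hf => hσ ⟨v, u, hvu, hf⟩) v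
  · refine le_trans (le_of_eq (by congr!))
      ((card_exists_frozen_le hl hk4 hext hDdeg hy1 hy hz hg).trans ?_)
    have hnr : (0 : ℝ) < n := by exact_mod_cast hn0
    -- Against at most $nD$ pairs, $n^{-2}$ leaves $D/n\le\delta$.
    have hexp : Real.exp (-((k - 2 : ℕ) : ℝ) ^ q) ≤ 1 / (n : ℝ) ^ 2 := by
      calc Real.exp (-((k - 2 : ℕ) : ℝ) ^ q) ≤ Real.exp (-(2 * Real.log n)) := by gcongr
        _ = 1 / (n : ℝ) ^ 2 := by
          rw [Real.exp_neg, one_div, two_mul, Real.exp_add, Real.exp_log hnr, sq]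
    rw [Fintype.card_fin, ← mul_assoc, ← mul_assoc]
    gcongr
    calc (n : ℝ) * D * Real.exp (-((k - 2 : ℕ) : ℝ) ^ q) ≤ n * (δ * n) * (1 / (n : ℝ) ^ 2) := by
          gcongr
      _ = δ := by field_simp
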